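/- Let $s\in\mathbb N$, $s\ge 1$, and $k_F>0$. Let $\mathfrak h=L^2(\mathbb T^3;\mathbb C^s)$ with $\mathbb T^3=[0,2\pi]^3$ (periodic boundary conditions), with plane waves $u_{p,\sigma}(x)=(2\pi)^{-3/2}e^{ip\cdot x}v_\sigma$, $p\in\mathbb Z^3$, $1\le\sigma\le s$, where $v_\sigma$ is the standard basis of $\mathbb C^s$. Let $B_F=\{p\in\mathbb Z^3: |p|\le k_F\}$, $N=s|B_F|$, $\mathcal H_N=\bigwedge^N\mathfrak h$, and let $c_{p,\sigma}^*,c_{p,\sigma}$ be the fermionic creation and annihilation operators of $u_{p,\sigma}$. Put $\mathbb Z^3_*=\mathbb Z^3\setminus\{0\}$ and, for $k\in\mathbb Z^3_*$, $L_k=(B_F+k)\setminus B_F$, and $$b_{k,p}=\frac1{\sqrt s}\sum_{\sigma=1}^s c_{p-k,\sigma}^*c_{p,\sigma},\qquad b_{k,p}^*=\frac1{\sqrt s}\sum_{\sigma=1}^s c_{p,\sigma}^*c_{p-k,\sigma}\qquad(p\in L_k),$$ $$\mathcal N_E=\sum_{p\in\mathbb Z^3\setminus B_F}\sum_{\sigma=1}^s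 c_{p,\sigma}^*c_{p,\sigma}\quad\text{on }\mathcal H_N .$$ Let $K_l:\ell^2(L_l)\to\ell^2(L_l)$, $l\in\mathbb Z^3_*$, be symmetric operators on the real Hilbert spaces $\ell^2(L_l)$, with standard bases $(e_p)_{p\in L_l}$, such that $\sum_{l\in\mathbb Z^3_*}\|K_l\|_{\mathrm{HS}}^2<\infty$. Then the sum defining $\mathcal N_E\Psi$ converges unconditionally for every $\Psi\in\mathcal H_N$; the sum over $l$ in $$\mathcal K=\frac12\sum_{l\in\mathbb Z^3_*}\ \sum_{p,q\in L_l}\langle e_p,K_le_q\rangle\left(b_{l,p}b_{-l,-q}-b_{-l,-q}^*b_{l,p}^*\right)$$ converges unconditionally in operator norm, so that $\mathcal K$ is a bounded operator on $\mathcal H_N$; and for all $\Phi,\Psi\in\mathcal H_N$ $$|\langle\Phi,\mathcal K\Psi\rangle|\le\sqrt5\,\sqrt{\sum_{l\in\mathbb Z^3_*}\|K_l\|_{\mathrm{HS}}^2}\,\sqrt{\langle\Phi,(\mathcal N_E+1)\Phi\rangle\,\langle\Psi,(\mathcal N_E+1)\Psi\rangle}.$$ -/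

import Mathlib

namespace FermiGas

noncomputable section WedgeInner

open exteriorPower

variable {E : Type*} [NormedAddCommGroup E] [InnerProductSpace ℂ E]

/-- For `y = (y₁, …, yₙ)`, the conjugate-linear functional on `⋀ⁿ E` which takes the value
`det ⟨xⱼ, yᵢ⟩` at `x₁ ∧ ⋯ ∧ xₙ`. -/
def gramFunctional (n : ℕ) (y : Fin n → E) : ⋀[ℂ]^n E →ₗ⋆[ℂ] ℂ :=
  (starLinearEquiv ℂ (A := ℂ)).toLinearMap.comp
    (pairingDual ℂ E n (ιMulti ℂ n fun i => (innerSL ℂ (y i)).toLinearMap))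

theorem gramFunctional_ιMulti (n : ℕ) (x y : Fin n → E) :
    gramFunctional n y (ιMulti ℂ n x) = Matrix.det (.of fun i j => inner ℂ (x j) (y i)) := by
  simp only [gramFunctional, LinearMap.comp_apply, pairingDual_ιMulti_ιMulti]
  change star (Matrix.det _) = _
  rw [← Matrix.det_conjTranspose]
  congr 1
  ext i j
  simp [Matrix.conjTranspose_apply]

theorem conjLinear_ext {n : ℕ} {f g : ⋀[ℂ]^n E →ₗ⋆[ℂ] ℂ}
    (h : ∀ x, f (ιMulti ℂ n x) = g (ιMulti ℂ n x)) : f = g := by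
  refine LinearMap.ext_on_range (ιMulti_span ℂ n E) h

/-- The sesquilinear form on `⋀ⁿ E`, conjugate-linear in the second displayed argument:
`wedgeForm n y x` is the inner product `⟨x, y⟩`. -/
def wedgeForm (n : ℕ) : ⋀[ℂ]^n E →ₗ[ℂ] ⋀[ℂ]^n E →ₗ⋆[ℂ] ℂ :=
  alternatingMapLinearEquiv
    { toFun := gramFunctional n
      map_update_add' := by
        intro inst y i a b
        refine conjLinear_ext fun x => ?_
        simp only [LinearMap.add_apply, gramFunctional_ιMulti]
        obtain rfl : inst = instDecidableEqFin n := Subsingleton.elim _ _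
        have h : ∀ c : E, (Matrix.of fun k j => inner ℂ (x j) (Function.update y i c k)) =
            (Matrix.of fun k j => inner ℂ (x j) (y k)).updateRow i
              (fun j => inner ℂ (x j) c) := by
          intro c; ext k j
          by_cases hk : k = i
          · subst hk; simp
          · simp [hk]
        rw [h, h, h, ← Matrix.det_updateRow_add]
        congr 2; ext j; simp
      map_update_smul' := by
        intro inst y i r a
        refine conjLinear_ext fun x => ?_
        simp only [LinearMap.smul_apply, gramFunctional_ιMulti]
        obtain rfl : inst = instDecidableEqFin n := Subsingleton.elim _ _
        have h : ∀ c : E, (Matrix.of fun k j => inner ℂ (x j) (Function.update y i c k)) =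
            (Matrix.of fun k j => inner ℂ (x j) (y k)).updateRow i
              (fun j => inner ℂ (x j) c) := by
          intro c; ext k j
          by_cases hk : k = i
          · subst hk; simp
          · simp [hk]
        rw [h, h, smul_eq_mul, ← Matrix.det_updateRow_smul]
        congr 2; ext j; simp
      map_eq_zero_of_eq' := by
        intro y i j hy hij
        refine conjLinear_ext fun x => ?_
        rw [gramFunctional_ιMulti, LinearMap.zero_apply]
        exact Matrix.det_zero_of_row_eq hij (by ext k; simp [hy]) }

theorem wedgeForm_ιMulti (n : ℕ) (x y : Fin n → E) :
    wedgeForm n (ιMulti ℂ n y) (ιMulti ℂ n x) =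
      Matrix.det (.of fun i j => inner ℂ (x i) (y j)) := by
  rw [wedgeForm, alternatingMapLinearEquiv_apply_ιMulti, ← Matrix.det_transpose]
  exact gramFunctional_ιMulti n x y

theorem wedgeForm_conj (n : ℕ) (x y : ⋀[ℂ]^n E) :
    star (wedgeForm n x y) = wedgeForm n y x := by
  have hx : x ∈ Submodule.span ℂ (Set.range (ιMulti ℂ n (M := E))) := by
    rw [ιMulti_span]; trivial
  have hy : y ∈ Submodule.span ℂ (Set.range (ιMulti ℂ n (M := E))) := by
    rw [ιMulti_span]; trivial
  induction hx using Submodule.span_induction with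
  | zero => simp
  | add a b _ _ ha hb => simp only [map_add, LinearMap.add_apply, star_add, ha, hb]
  | smul r a _ ha => simp [LinearMap.map_smulₛₗ, ← ha]
  | mem a ha =>
    obtain ⟨a, rfl⟩ := ha
    induction hy using Submodule.span_induction with
    | zero => simp
    | add c d _ _ hc hd => simp only [map_add, LinearMap.add_apply, star_add, hc, hd]
    | smul r c _ hc => simp [LinearMap.map_smulₛₗ, ← hc]
    | mem c hc =>
      obtain ⟨c, rfl⟩ := hc
      rw [wedgeForm_ιMulti, wedgeForm_ιMulti, ← Matrix.det_conjTranspose]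
      congr 1; ext i j; simp [Matrix.conjTranspose_apply]

/-- Exterior products of an orthonormal family are orthonormal. -/
theorem wedgeForm_orthonormal {ι : Type*} [LinearOrder ι] {v : ι → E} (hv : Orthonormal ℂ v)
    (n : ℕ) (s t : Set.powersetCard ι n) :
    wedgeForm n (ιMulti_family ℂ n v s) (ιMulti_family ℂ n v t) = if s = t then 1 else 0 := by
  simp only [ιMulti_family, wedgeForm_ιMulti]
  split_ifs with h
  · subst h
    rw [← Matrix.det_one (n := Fin n)]
    congr 1
    ext i j
    simp [Matrix.one_apply, orthonormal_iff_ite.mp hv]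
  · obtain ⟨x, hxt, hxs⟩ := (Set.powersetCard.exists_mem_notMem_iff_ne t s).mp (.symm h)
    simp only [Set.mem_range, not_exists,
      ← Set.powersetCard.mem_range_ofFinEmbEquiv_symm_iff_mem] at hxs hxt
    obtain ⟨i, rfl⟩ := hxt
    exact Matrix.det_eq_zero_of_row_eq_zero i
      (fun j => hv.inner_eq_zero (fun h => hxs j h.symm))

/-- Every element of `⋀ⁿ E` is a combination of exterior products of a finite orthonormal family. -/
theorem exists_orthonormal_mem_span (n : ℕ) (x : ⋀[ℂ]^n E) :
    ∃ (m : ℕ) (v : Fin m → E), Orthonormal ℂ v ∧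
      x ∈ Submodule.span ℂ (Set.range (ιMulti_family ℂ n v)) := by
  have hx : x ∈ Submodule.span ℂ (Set.range (ιMulti ℂ n (M := E))) := by
    rw [ιMulti_span]; trivial
  obtain ⟨F, hF, hxF⟩ : ∃ F : Submodule ℂ E, FiniteDimensional ℂ F ∧
      x ∈ (map n F.subtype).range := by
    induction hx using Submodule.span_induction with
    | zero => exact ⟨⊥, inferInstance, Submodule.zero_mem _⟩
    | mem a ha =>
      obtain ⟨a, rfl⟩ := ha
      refine ⟨Submodule.span ℂ (Set.range a), FiniteDimensional.span_of_finite ℂ (Set.finite_range a),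
        ιMulti ℂ n (fun i => ⟨a i, Submodule.subset_span ⟨i, rfl⟩⟩), ?_⟩
      rw [map_apply_ιMulti]; rfl
    | smul r a _ ha =>
      obtain ⟨F, hF, h⟩ := ha
      exact ⟨F, hF, Submodule.smul_mem _ _ h⟩
    | add a b _ _ ha hb =>
      obtain ⟨F, hF, h⟩ := ha
      obtain ⟨G, hG, h'⟩ := hb
      have mono : ∀ {A B : Submodule ℂ E} (_ : A ≤ B),
          (map n A.subtype).range ≤ (map n B.subtype).range := by
        intro A B hAB
        rw [← Submodule.subtype_comp_inclusion A B hAB, exteriorPower.map_comp]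
        exact LinearMap.range_comp_le_range _ _
      exact ⟨F ⊔ G, inferInstance,
        Submodule.add_mem _ (mono le_sup_left h) (mono le_sup_right h')⟩
  let b := stdOrthonormalBasis ℂ F
  refine ⟨_, fun i => (b i : E), b.orthonormal.comp_linearIsometry F.subtypeₗᵢ, ?_⟩
  have hb : Submodule.span ℂ (Set.range fun i => (b i : E)) = F := by
    have := congrArg (Submodule.map F.subtype) b.toBasis.span_eq
    rw [Submodule.map_span, ← Set.range_comp, Submodule.map_top, Submodule.range_subtype] at this
    simpa [Function.comp_def] using this
  rw [← ιMulti_family_span, hb]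
  exact hxF

theorem wedgeForm_self (n : ℕ) (x : ⋀[ℂ]^n E) :
    0 ≤ (wedgeForm n x x).re ∧ (wedgeForm n x x = 0 → x = 0) := by
  obtain ⟨m, v, hv, hx⟩ := exists_orthonormal_mem_span n x
  obtain ⟨c, rfl⟩ := (Submodule.mem_span_range_iff_exists_fun ℂ).mp hx
  have h : wedgeForm n (∑ s, c s • ιMulti_family ℂ n v s) (∑ s, c s • ιMulti_family ℂ n v s) =
      ((∑ s, ‖c s‖ ^ 2 : ℝ) : ℂ) := by
    simp only [map_sum, map_smul, LinearMap.sum_apply, LinearMap.smul_apply,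
      LinearMap.map_smulₛₗ, wedgeForm_orthonormal hv]
    simp [Complex.mul_conj, Complex.normSq_eq_norm_sq, mul_comm]
  rw [h]
  refine ⟨by rw [Complex.ofReal_re]; positivity, fun h0 => ?_⟩
  rw [Complex.ofReal_eq_zero, Finset.sum_eq_zero_iff_of_nonneg (fun _ _ => by positivity)] at h0
  exact Finset.sum_eq_zero fun s hs => by simp [show c s = 0 by simpa using h0 s hs]

instance wedgeCore (n : ℕ) : InnerProductSpace.Core ℂ (⋀[ℂ]^n E) where
  inner x y := wedgeForm n y x
  conj_inner_symm x y := wedgeForm_conj n x y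
  re_inner_nonneg x := (wedgeForm_self n x).1
  definite x := (wedgeForm_self n x).2
  add_left x y z := by simp
  smul_left x y r := by simp [LinearMap.map_smulₛₗ]

instance wedgeNormed (n : ℕ) : NormedAddCommGroup (⋀[ℂ]^n E) :=
  InnerProductSpace.Core.toNormedAddCommGroup (𝕜 := ℂ)

instance wedgeInner (n : ℕ) : InnerProductSpace ℂ (⋀[ℂ]^n E) :=
  InnerProductSpace.ofCore _

/-- `⟨x₁ ∧ ⋯ ∧ xₙ, y₁ ∧ ⋯ ∧ yₙ⟩ = det ⟨xᵢ, yⱼ⟩`. -/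
theorem inner_ιMulti_ιMulti (n : ℕ) (x y : Fin n → E) :
    inner ℂ (ιMulti ℂ n x) (ιMulti ℂ n y) = Matrix.det (.of fun i j => inner ℂ (x i) (y j)) :=
  wedgeForm_ιMulti n x y

end WedgeInner

noncomputable section Fock

open exteriorPower

variable {E : Type*} [NormedAddCommGroup E] [InnerProductSpace ℂ E]

/-- Exterior multiplication `x ↦ u ∧ x`. -/
def wedgeLeft (n : ℕ) (u : E) : ⋀[ℂ]^n E →ₗ[ℂ] ⋀[ℂ]^(n + 1) E :=
  alternatingMapLinearEquiv ((ιMulti ℂ (n + 1)).curryLeft u)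

theorem wedgeLeft_ιMulti (n : ℕ) (u : E) (x : Fin n → E) :
    wedgeLeft n u (ιMulti ℂ n x) = ιMulti ℂ (n + 1) (Matrix.vecCons u x) := by
  simp [wedgeLeft]

/-- Contraction `x₀ ∧ ⋯ ∧ xₙ ↦ ∑ᵢ (-1)ⁱ ⟨u, xᵢ⟩ x₀ ∧ ⋯ ∧ x̂ᵢ ∧ ⋯ ∧ xₙ`. -/
def contractLeft (n : ℕ) (u : E) : ⋀[ℂ]^(n + 1) E →ₗ[ℂ] ⋀[ℂ]^n E :=
  alternatingMapLinearEquiv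
    (AlternatingMap.alternatizeUncurryFin ((innerSL ℂ u).toLinearMap.smulRight (ιMulti ℂ n)))

theorem contractLeft_ιMulti (n : ℕ) (u : E) (x : Fin (n + 1) → E) :
    contractLeft n u (ιMulti ℂ (n + 1) x) =
      ∑ i : Fin (n + 1), (-1 : ℂ) ^ (i : ℕ) • inner ℂ u (x i) • ιMulti ℂ n (i.removeNth x) := by
  simp only [contractLeft, alternatingMapLinearEquiv_apply_ιMulti,
    AlternatingMap.alternatizeUncurryFin_apply]
  refine Finset.sum_congr rfl fun i _ => ?_
  rcases Nat.even_or_odd (i : ℕ) with h | h <;> simp [h.neg_one_pow]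

theorem inner_wedgeLeft (n : ℕ) (u : E) (x : ⋀[ℂ]^n E) (y : ⋀[ℂ]^(n + 1) E) :
    inner ℂ (wedgeLeft n u x) y = inner ℂ x (contractLeft n u y) := by
  have hx : x ∈ Submodule.span ℂ (Set.range (ιMulti ℂ n (M := E))) := by
    rw [ιMulti_span]; trivial
  have hy : y ∈ Submodule.span ℂ (Set.range (ιMulti ℂ (n + 1) (M := E))) := by
    rw [ιMulti_span]; trivial
  induction hx using Submodule.span_induction with
  | zero => simp
  | add a b _ _ ha hb => simp only [map_add, inner_add_left, ha, hb]
  | smul r a _ ha => simp only [map_smul, inner_smul_left, ha]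
  | mem a ha =>
    obtain ⟨a, rfl⟩ := ha
    induction hy using Submodule.span_induction with
    | zero => simp
    | add c d _ _ hc hd => simp only [map_add, inner_add_right, hc, hd]
    | smul r c _ hc => simp only [map_smul, inner_smul_right, hc]
    | mem c hc =>
      obtain ⟨c, rfl⟩ := hc
      rw [wedgeLeft_ιMulti, contractLeft_ιMulti, inner_ιMulti_ιMulti, Matrix.det_succ_row_zero,
        inner_sum]
      refine Finset.sum_congr rfl fun i _ => ?_
      rw [inner_smul_right, inner_smul_right, inner_ιMulti_ιMulti, ← mul_assoc]
      rfl

theorem contractLeft_wedgeLeft_zero (u v : E) (x : ⋀[ℂ]^0 E) :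
    contractLeft 0 u (wedgeLeft 0 v x) = inner ℂ u v • x := by
  have h : contractLeft 0 u ∘ₗ wedgeLeft 0 v = inner ℂ u v • LinearMap.id := by
    refine linearMap_ext (AlternatingMap.ext fun y => ?_)
    simp only [LinearMap.compAlternatingMap_apply, LinearMap.comp_apply, wedgeLeft_ιMulti,
      contractLeft_ιMulti, LinearMap.smul_apply, LinearMap.id_apply]
    simp [Subsingleton.elim _ y]
  exact LinearMap.congr_fun h x

theorem contractLeft_wedgeLeft_succ (n : ℕ) (u v : E) (x : ⋀[ℂ]^(n + 1) E) :
    contractLeft (n + 1) u (wedgeLeft (n + 1) v x) =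
      inner ℂ u v • x - wedgeLeft n v (contractLeft n u x) := by
  have h : contractLeft (n + 1) u ∘ₗ wedgeLeft (n + 1) v =
      inner ℂ u v • LinearMap.id - wedgeLeft n v ∘ₗ contractLeft n u := by
    refine linearMap_ext (AlternatingMap.ext fun y => ?_)
    simp only [LinearMap.compAlternatingMap_apply, LinearMap.comp_apply, wedgeLeft_ιMulti,
      contractLeft_ιMulti, LinearMap.smul_apply, LinearMap.id_apply, LinearMap.sub_apply,
      map_sum, map_smul]
    rw [Fin.sum_univ_succ, sub_eq_add_neg, ← Finset.sum_neg_distrib]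
    congr 1
    · simp
    · refine Finset.sum_congr rfl fun i _ => ?_
      have : (i.succ.removeNth (Matrix.vecCons v y) : Fin (n + 1) → E) =
          Matrix.vecCons v (i.removeNth y) := by
        ext j
        refine Fin.cases ?_ (fun j => ?_) j <;> simp [Fin.removeNth]
      simp [this, pow_succ]
  exact LinearMap.congr_fun h x

theorem norm_wedgeLeft_le (n : ℕ) (u : E) (x : ⋀[ℂ]^n E) :
    ‖wedgeLeft n u x‖ ≤ ‖u‖ * ‖x‖ := by
  have h : ‖wedgeLeft n u x‖ ^ 2 ≤ (‖u‖ * ‖x‖) ^ 2 := by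
    rw [← inner_self_eq_norm_sq (𝕜 := ℂ), inner_wedgeLeft]
    cases n with
    | zero =>
      rw [contractLeft_wedgeLeft_zero, inner_smul_right, inner_self_eq_norm_sq_to_K,
        inner_self_eq_norm_sq_to_K, mul_pow]
      norm_cast
    | succ n =>
      rw [contractLeft_wedgeLeft_succ, inner_sub_right, inner_smul_right,
        ← inner_conj_symm x (wedgeLeft n u _), inner_wedgeLeft, inner_self_eq_norm_sq_to_K,
        inner_self_eq_norm_sq_to_K, inner_self_eq_norm_sq_to_K, mul_pow]
      have : RCLike.re (((‖u‖ : ℂ) ^ 2 * (‖x‖ : ℂ) ^ 2 -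
          (starRingEnd ℂ) ((‖contractLeft n u x‖ : ℂ) ^ 2))) =
          ‖u‖ ^ 2 * ‖x‖ ^ 2 - ‖contractLeft n u x‖ ^ 2 := by
        rw [map_pow, Complex.conj_ofReal]; norm_cast
      exact this.trans_le (sub_le_self _ (by positivity))
  exact le_of_sq_le_sq h (by positivity)

variable (E) in
/-- The fermionic `n`-particle space `⋀ⁿ E`: the Hilbert space completion of the algebraic exterior
power with `⟨x₁ ∧ ⋯ ∧ xₙ, y₁ ∧ ⋯ ∧ yₙ⟩ = det ⟨xᵢ, yⱼ⟩`. -/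
abbrev FermionSpace (n : ℕ) : Type _ := UniformSpace.Completion (⋀[ℂ]^n E)

/-- The creation operator `c*(u)`, the continuous extension of `x ↦ u ∧ x`. -/
def create (n : ℕ) (u : E) : FermionSpace E n →L[ℂ] FermionSpace E (n + 1) :=
  ((wedgeLeft n u).mkContinuous ‖u‖ (norm_wedgeLeft_le n u)).completion

/-- The annihilation operator `c(u)`, the adjoint of `c*(u)`. -/
def annihilate (n : ℕ) (u : E) : FermionSpace E (n + 1) →L[ℂ] FermionSpace E n :=
  ContinuousLinearMap.adjoint (create n u)

/-- The operator `c*(u) c(v)` on the `n`-particle space (`c(v)` vanishes on the vacuum sector). -/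
def createAnnihilate (u v : E) : (n : ℕ) → FermionSpace E n →L[ℂ] FermionSpace E n
  | 0 => 0
  | n + 1 => create n u ∘L annihilate n v

end Fock
end FermiGas

namespace FermiGas

noncomputable section PlaneWaves

open MeasureTheory

/-- The torus `𝕋³ = [0, 2π]³` with periodic boundary conditions. -/
abbrev Torus : Type := Fin 3 → AddCircle (2 * Real.pi)

instance : Fact (0 < 2 * Real.pi) := ⟨Real.two_pi_pos⟩

/-- The one-particle space `𝔥 = L²(𝕋³; ℂˢ)`. -/
abbrev OneParticle (s : ℕ) : Type := Lp (EuclideanSpace ℂ (Fin s)) 2 (volume : Measure Torus)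

/-- The character `x ↦ e^{ip·x}`. -/
def torusChar (p : Fin 3 → ℤ) : C(Torus, ℂ) where
  toFun x := ∏ i, fourier (p i) (x i)
  continuous_toFun := by fun_prop

theorem torusChar_coe (p : Fin 3 → ℤ) (x : Fin 3 → ℝ) :
    torusChar p (fun i => (x i : AddCircle (2 * Real.pi))) =
      Complex.exp (Complex.I * ∑ i, (p i : ℂ) * (x i : ℂ)) := by
  have : (Real.pi : ℂ) ≠ 0 := by exact_mod_cast Real.pi_ne_zero
  simp only [torusChar, ContinuousMap.coe_mk, fourier_coe_apply, ← Complex.exp_sum,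
    Finset.mul_sum]
  congr 1
  refine Finset.sum_congr rfl fun i _ => ?_
  push_cast
  field_simp

/-- The plane wave `x ↦ (2π)^{-3/2} e^{ip·x} v_σ` as a continuous function. -/
def planeWaveFun {s : ℕ} (a : (Fin 3 → ℤ) × Fin s) : C(Torus, EuclideanSpace ℂ (Fin s)) where
  toFun x := EuclideanSpace.single a.2
    ((((2 * Real.pi) ^ (-(3 / 2) : ℝ) : ℝ) : ℂ) * torusChar a.1 x)
  continuous_toFun := by
    have : Continuous fun z : ℂ => EuclideanSpace.single (𝕜 := ℂ) a.2 z :=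
      (LinearMap.continuous_of_finiteDimensional
        ((LinearMap.id : ℂ →ₗ[ℂ] ℂ).smulRight (EuclideanSpace.single a.2 (1 : ℂ)))).congr
        fun z => by ext i; by_cases hi : i = a.2 <;> simp [hi]
    exact this.comp (by fun_prop)

/-- The plane wave state `u_{p,σ} ∈ 𝔥`, `u_{p,σ}(x) = (2π)^{-3/2} e^{ip·x} v_σ`. -/
def planeWave {s : ℕ} (a : (Fin 3 → ℤ) × Fin s) : OneParticle s :=
  ContinuousMap.toLp 2 volume ℂ (planeWaveFun a)

theorem torusChar_add (p q : Fin 3 → ℤ) : torusChar (p + q) = torusChar p * torusChar q := by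
  ext x
  simp [torusChar, Finset.prod_mul_distrib]

theorem torusChar_neg (p : Fin 3 → ℤ) : torusChar (-p) = star (torusChar p) := by
  ext x
  simp [torusChar]

theorem torusChar_zero : torusChar 0 = 1 := by
  ext x
  simp [torusChar]

theorem integral_torusChar (p : Fin 3 → ℤ) :
    ∫ x, torusChar p x = if p = 0 then (((2 * Real.pi) ^ 3 : ℝ) : ℂ) else 0 := by
  have h1 : ∀ n : ℤ, ∫ x : AddCircle (2 * Real.pi), fourier n x =
      if n = 0 then ((2 * Real.pi : ℝ) : ℂ) else 0 := by
    intro n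
    have h := orthonormal_iff_ite.mp (orthonormal_fourier (T := 2 * Real.pi)) 0 n
    rw [ContinuousMap.inner_toLp] at h
    simp only [fourier_zero, map_one, mul_one] at h
    rw [AddCircle.integral_haarAddCircle, inv_smul_eq_iff₀ Real.two_pi_pos.ne'] at h
    rw [h]
    by_cases hn : n = 0
    · simp [hn]
    · simp [hn, Ne.symm hn]
  have : ∀ x, torusChar p x = ∏ i, fourier (p i) (x i) := fun _ => rfl
  simp_rw [this]
  rw [MeasureTheory.integral_fintype_prod_volume_eq_prod (𝕜 := ℂ)
    (fun i (x : AddCircle (2 * Real.pi)) => (fourier (p i) x : ℂ))]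
  simp_rw [h1]
  split_ifs with hp
  · simp [hp]
  · obtain ⟨i, hi⟩ := Function.ne_iff.mp hp
    exact Finset.prod_eq_zero (Finset.mem_univ i) (if_neg hi)

theorem orthonormal_planeWave (s : ℕ) :
    Orthonormal ℂ (planeWave : (Fin 3 → ℤ) × Fin s → OneParticle s) := by
  rw [orthonormal_iff_ite]
  rintro ⟨p, σ⟩ ⟨q, τ⟩
  have h : inner ℂ (planeWave (p, σ)) (planeWave (q, τ)) =
      ∫ x, inner ℂ (planeWaveFun (p, σ) x) (planeWaveFun (q, τ) x) := by
    rw [L2.inner_def]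
    refine integral_congr_ae ?_
    filter_upwards [ContinuousMap.coeFn_toLp (𝕜 := ℂ) (p := 2) volume (planeWaveFun (p, σ)),
      ContinuousMap.coeFn_toLp (𝕜 := ℂ) (p := 2) volume (planeWaveFun (q, τ))] with x h1 h2
    rw [planeWave, planeWave, h1, h2]
  have hc : ((((2 * Real.pi) ^ (-(3 / 2) : ℝ) : ℝ) : ℂ) *
      (((2 * Real.pi) ^ (-(3 / 2) : ℝ) : ℝ) : ℂ)) * (((2 * Real.pi) ^ 3 : ℝ) : ℂ) = 1 := by
    rw [← Complex.ofReal_mul, ← Complex.ofReal_mul, ← Real.rpow_add Real.two_pi_pos,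
      ← Real.rpow_natCast, ← Real.rpow_add Real.two_pi_pos]
    norm_num
  have hx : ∀ x, inner ℂ (planeWaveFun (p, σ) x) (planeWaveFun (q, τ) x) =
      (if σ = τ then 1 else 0) * ((((2 * Real.pi) ^ (-(3 / 2) : ℝ) : ℝ) : ℂ) *
      (((2 * Real.pi) ^ (-(3 / 2) : ℝ) : ℝ) : ℂ)) * torusChar (q - p) x := by
    intro x
    rw [sub_eq_add_neg, torusChar_add, torusChar_neg]
    simp only [planeWaveFun, ContinuousMap.coe_mk, ContinuousMap.mul_apply,
      ContinuousMap.star_apply, EuclideanSpace.inner_single_left, map_mul, Complex.conj_ofReal]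
    by_cases hσ : σ = τ
    · subst hσ; simp; ring
    · simp [hσ]
  rw [h]
  simp_rw [hx]
  rw [integral_const_mul, integral_torusChar]
  simp only [sub_eq_zero]
  by_cases hσ : σ = τ
  · by_cases hp : p = q
    · subst hσ hp; simpa using hc
    · simp [hp, Ne.symm hp]
  · simp [hσ]

theorem span_torusChar_closure_eq_top :
    (Submodule.span ℂ (Set.range torusChar)).topologicalClosure = ⊤ := by
  have hadj : (Algebra.adjoin ℂ (Set.range torusChar)).toSubmodule =
      Submodule.span ℂ (Set.range torusChar) := by
    apply Algebra.adjoin_eq_span_of_subset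
    refine .trans (fun x => Submonoid.closure_induction (fun _ => id) ⟨0, ?_⟩ ?_)
      Submodule.subset_span
    · exact torusChar_zero
    · rintro _ _ _ _ ⟨m, rfl⟩ ⟨n, rfl⟩
      exact ⟨m + n, torusChar_add m n⟩
  let A : StarSubalgebra ℂ C(Torus, ℂ) :=
    { toSubalgebra := Algebra.adjoin ℂ (Set.range torusChar)
      star_mem' := by
        change Algebra.adjoin ℂ (Set.range torusChar) ≤
          star (Algebra.adjoin ℂ (Set.range torusChar))
        refine Algebra.adjoin_le ?_
        rintro _ ⟨n, rfl⟩
        refine Algebra.subset_adjoin ⟨-n, ?_⟩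
        rw [torusChar_neg] }
  have hsep : A.SeparatesPoints := by
    intro x y hxy
    obtain ⟨i, hi⟩ := Function.ne_iff.mp hxy
    refine ⟨_, ⟨torusChar (Pi.single i 1), Algebra.subset_adjoin ⟨Pi.single i 1, rfl⟩, rfl⟩, ?_⟩
    have hs : ∀ z : Torus, torusChar (Pi.single i 1) z = fourier 1 (z i) := by
      intro z
      simp only [torusChar, ContinuousMap.coe_mk]
      rw [Finset.prod_eq_single i (fun j _ hj => by simp [Pi.single_eq_of_ne hj]) (by simp)]
      simp
    dsimp only
    rw [hs, hs, fourier_one, fourier_one]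
    exact fun h => hi (AddCircle.injective_toCircle Real.two_pi_pos.ne' (Circle.ext h))
  have := ContinuousMap.starSubalgebra_topologicalClosure_eq_top_of_separatesPoints A hsep
  rw [← hadj]
  exact congrArg (Subalgebra.toSubmodule <| StarSubalgebra.toSubalgebra ·) this

theorem span_planeWave_closure_eq_top (s : ℕ) :
    (Submodule.span ℂ (Set.range
      (planeWave : (Fin 3 → ℤ) × Fin s → OneParticle s))).topologicalClosure = ⊤ := by
  have hc : (((2 * Real.pi) ^ (-(3 / 2) : ℝ) : ℝ) : ℂ) ≠ 0 := by
    exact_mod_cast (Real.rpow_pos_of_pos Real.two_pi_pos _).ne'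
  have hC : (Submodule.span ℂ (Set.range
      (planeWaveFun : (Fin 3 → ℤ) × Fin s → _))).topologicalClosure = ⊤ := by
    rw [eq_top_iff]
    intro f _
    let e : Fin s → ℂ →L[ℂ] EuclideanSpace ℂ (Fin s) := fun σ =>
      (ContinuousLinearMap.id ℂ ℂ).smulRight (EuclideanSpace.single σ (1 : ℂ))
    let J : Fin s → C(Torus, ℂ) →L[ℂ] C(Torus, EuclideanSpace ℂ (Fin s)) := fun σ =>
      (e σ).compLeftContinuous ℂ Torus
    have hJ : ∀ σ g, J σ g ∈ (Submodule.span ℂ (Set.range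
        (planeWaveFun : (Fin 3 → ℤ) × Fin s → _))).topologicalClosure := by
      intro σ g
      have hg : g ∈ (Submodule.span ℂ (Set.range torusChar)).topologicalClosure := by
        rw [span_torusChar_closure_eq_top]; trivial
      have hle : Submodule.span ℂ (Set.range torusChar) ≤ (Submodule.span ℂ (Set.range
          (planeWaveFun : (Fin 3 → ℤ) × Fin s → _))).comap (J σ).toLinearMap := by
        rw [Submodule.span_le]
        rintro _ ⟨p, rfl⟩
        have : J σ (torusChar p) =
            (((2 * Real.pi) ^ (-(3 / 2) : ℝ) : ℝ) : ℂ)⁻¹ • planeWaveFun (p, σ) := by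
          ext x i
          simp [J, e, planeWaveFun]
          by_cases hi : i = σ
          · subst hi; simp; field_simp
          · simp [hi]
        rw [SetLike.mem_coe, Submodule.mem_comap, ContinuousLinearMap.coe_coe, this]
        exact Submodule.smul_mem _ _ (Submodule.subset_span ⟨(p, σ), rfl⟩)
      have hcl := map_mem_closure
        (t := (Submodule.span ℂ (Set.range (planeWaveFun : (Fin 3 → ℤ) × Fin s → _)) :
          Set C(Torus, EuclideanSpace ℂ (Fin s)))) (J σ).continuous hg fun x hx => hle hx
      exact hcl
    let f' : Fin s → C(Torus, ℂ) := fun σ => ⟨fun x => f x σ, by fun_prop⟩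
    have : f = ∑ σ, J σ (f' σ) := by
      ext x i
      simp [J, e, f', Finset.sum_apply, Pi.single_apply]
    rw [this]
    exact Submodule.sum_mem _ fun σ _ => hJ σ _
  have := (ContinuousMap.toLp_denseRange (E := EuclideanSpace ℂ (Fin s)) (p := 2)
    (volume : Measure Torus) ℂ (by norm_num)).topologicalClosure_map_submodule hC
  rw [Submodule.map_span, ← Set.range_comp] at this
  exact this

/-- The orthonormal basis of plane wave states. -/
def planeWaveBasis (s : ℕ) : HilbertBasis ((Fin 3 → ℤ) × Fin s) ℂ (OneParticle s) :=
  HilbertBasis.mk (orthonormal_planeWave s) (span_planeWave_closure_eq_top s).ge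

end PlaneWaves
end FermiGas

namespace FermiGas

noncomputable section Kernel

/-- The Euclidean norm of a momentum `p ∈ ℤ³`. -/
def momentumNorm (p : Fin 3 → ℤ) : ℝ :=
  ‖(WithLp.toLp 2 fun i => (p i : ℝ) : EuclideanSpace ℝ (Fin 3))‖

theorem finite_momentumNorm_le (R : ℝ) : {p : Fin 3 → ℤ | momentumNorm p ≤ R}.Finite := by
  refine (Set.finite_Icc (fun _ : Fin 3 => -⌈R⌉) (fun _ => ⌈R⌉)).subset fun p hp => ?_
  have h : ∀ i, |p i| ≤ ⌈R⌉ := fun i => by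
    have h1 := (PiLp.norm_apply_le
      (WithLp.toLp 2 fun i => (p i : ℝ) : EuclideanSpace ℝ (Fin 3)) i).trans hp
    have h2 : |(p i : ℝ)| ≤ R := by simpa using h1
    exact_mod_cast h2.trans (Int.le_ceil R)
  exact ⟨fun i => (abs_le.mp (h i)).1, fun i => (abs_le.mp (h i)).2⟩

/-- The Fermi ball `B_F`: all `p ∈ ℤ³` with `|p| ≤ k_F`. -/
def fermiBall (kF : ℝ) : Finset (Fin 3 → ℤ) := (finite_momentumNorm_le kF).toFinset

/-- The lune `L_k = (B_F + k) \ B_F`. -/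
def lune (kF : ℝ) (k : Fin 3 → ℤ) : Finset (Fin 3 → ℤ) :=
  (fermiBall kF).image (fun p => p + k) \ fermiBall kF

/-- The particle number `N = s |B_F|`. -/
def particleNumber (s : ℕ) (kF : ℝ) : ℕ := s * (fermiBall kF).card

/-- The `N`-particle space `ℋ_N = ⋀ᴺ L²(𝕋³; ℂˢ)` with `N = s |B_F|`. -/
abbrev ManyBody (s : ℕ) (kF : ℝ) : Type :=
  FermionSpace (OneParticle s) (particleNumber s kF)

/-- The operator `c*_{p,σ} c_{q,τ}` on `ℋ_N`, for `a = (p, σ)` and `b = (q, τ)`. -/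
def hop (s : ℕ) (kF : ℝ) (a b : (Fin 3 → ℤ) × Fin s) : ManyBody s kF →L[ℂ] ManyBody s kF :=
  createAnnihilate (planeWave a) (planeWave b) (particleNumber s kF)

/-- The excitation operator `b_{k,p} = s^{-1/2} ∑_σ c*_{p-k,σ} c_{p,σ}`. -/
def excite (s : ℕ) (kF : ℝ) (k p : Fin 3 → ℤ) : ManyBody s kF →L[ℂ] ManyBody s kF :=
  ((1 / √(s : ℝ) : ℝ) : ℂ) • ∑ σ, hop s kF (p - k, σ) (p, σ)

/-- The excitation operator `b*_{k,p} = s^{-1/2} ∑_σ c*_{p,σ} c_{p-k,σ}`. -/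
def exciteStar (s : ℕ) (kF : ℝ) (k p : Fin 3 → ℤ) : ManyBody s kF →L[ℂ] ManyBody s kF :=
  ((1 / √(s : ℝ) : ℝ) : ℂ) • ∑ σ, hop s kF (p, σ) (p - k, σ)

/-- The index set `B_Fᶜ × {1, …, s}`. -/
abbrev OuterState (s : ℕ) (kF : ℝ) : Type :=
  {a : (Fin 3 → ℤ) × Fin s // a.1 ∉ fermiBall kF}

/-- The excitation number operator `𝒩_E Ψ = ∑_{p ∉ B_F, σ} c*_{p,σ} c_{p,σ} Ψ`. -/
def excitationNumber (s : ℕ) (kF : ℝ) (Ψ : ManyBody s kF) : ManyBody s kF :=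
  ∑' a : OuterState s kF, hop s kF a.1 a.1 Ψ

/-- The real Hilbert space `ℓ²(L_k)`. -/
abbrev LuneSpace (kF : ℝ) (k : Fin 3 → ℤ) : Type := EuclideanSpace ℝ (lune kF k)

/-- The standard basis vector `e_p ∈ ℓ²(L_k)`. -/
abbrev luneVec {kF : ℝ} {k : Fin 3 → ℤ} (p : lune kF k) : LuneSpace kF k :=
  EuclideanSpace.single p 1

/-- The squared Hilbert–Schmidt norm `‖T‖²_HS = ∑_p ‖T e_p‖²`. -/
def hsNormSq {kF : ℝ} {k : Fin 3 → ℤ} (T : LuneSpace kF k →ₗ[ℝ] LuneSpace kF k) : ℝ :=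
  ∑ p, ‖T (luneVec p)‖ ^ 2

/-- The set `ℤ³_* = ℤ³ \ {0}`. -/
abbrev NonzeroMomentum : Type := {l : Fin 3 → ℤ // l ≠ 0}

/-- The contribution of `l` to the kernel,
`½ ∑_{p,q ∈ L_l} ⟨e_p, T e_q⟩ (b_{l,p} b_{-l,-q} - b*_{-l,-q} b*_{l,p})`. -/
def kernelTerm (s : ℕ) (kF : ℝ) (l : Fin 3 → ℤ) (T : LuneSpace kF l →ₗ[ℝ] LuneSpace kF l) :
    ManyBody s kF →L[ℂ] ManyBody s kF :=
  (1 / 2 : ℂ) • ∑ p : lune kF l, ∑ q : lune kF l,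
    ((inner ℝ (luneVec p) (T (luneVec q)) : ℝ) : ℂ) •
      (excite s kF l p ∘L excite s kF (-l) (-q) -
        exciteStar s kF (-l) (-q) ∘L exciteStar s kF l p)

/-- The quasi-bosonic Bogolubov kernel `𝒦` of the family `(K_l)`; the sum over `l ∈ ℤ³_*` is taken
in operator norm. -/
def bogolubovKernel (s : ℕ) (kF : ℝ)
    (K : (l : NonzeroMomentum) → LuneSpace kF l →ₗ[ℝ] LuneSpace kF l) :
    ManyBody s kF →L[ℂ] ManyBody s kF :=
  ∑' l : NonzeroMomentum, kernelTerm s kF l (K l)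

end Kernel

end FermiGas

open FermiGas

/-! In quasi-particle terms, put `a_x = c_x` for states outside the Fermi ball and `h_y = c*_y` for
states inside. Both families satisfy the canonical anticommutation relations (CAR), and they
anticommute with each other and with each other's adjoints. Each product `b_{l,p} b_{-l,-q}` is
then, up to sign and the factor `1/s`, a sum over spins of monomials `a_x h_y h_z a_p`. The momenta
`p` and `p - l` determine `l`, so monomials from different `l` never coincide. The whole sum over
`l` is therefore a single quartic form whose coefficients have squared norm `∑ ‖K_l‖²_HS`.

Write the quartic operator as `∑_p T_p a_p` with `T_p` cubic. Cauchy–Schwarz in `p` bounds the form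
by `(∑ ‖T_p* Φ‖²)^{1/2} (∑ ‖a_p Ψ‖²)^{1/2}`, and the second factor is controlled by `𝒩_E`. For the
first, `T_p` is odd, so the anticommutator of `T_p` and `T_p*` has no sextic part.
`tripleOp_identity` writes it, plus nonnegative squares, as a sum of normal-ordered squares, and
these grow only linearly in the particle and hole numbers. Antisymmetrizing the coefficients in the
two hole indices costs a factor `4` and the normal-ordered terms a factor `5/4`, whence the `5` in
`norm_star_triple_sq_le`.

Holes are counted by `𝒩_E` too: on the sector with exactly as many particles as states in the ball,
the number of holes inside equals the number of particles outside (`sum_norm_sq_fockCreate`). This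
rests on `∑ c*_a c_a = N` over the complete plane wave basis, proved in `hasSum_create_annihilate`.

Finally, `𝒦` is half the difference of this form and its adjoint form, so `√5` survives. Since `𝒩_E
≤ N`, the same estimate on finite sets of `l` gives the Cauchy criterion in operator norm, and the
bound passes to the limit. -/

namespace FermiGas

/-! ### Anticommutation relations between particle sectors, and the number operator. -/

noncomputable section SectorAlgebra

open exteriorPower Filter Topology

variable {E : Type*} [NormedAddCommGroup E] [InnerProductSpace ℂ E]

theorem create_coe (n : ℕ) (u : E) (x : ⋀[ℂ]^n E) :
    create n u (x : FermionSpace E n) = (wedgeLeft n u x : FermionSpace E (n + 1)) :=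
  ContinuousLinearMap.completion_apply_coe _ x

theorem inner_create_left (n : ℕ) (u : E) (x : FermionSpace E n) (y : FermionSpace E (n + 1)) :
    inner ℂ (create n u x) y = inner ℂ x (annihilate n u y) :=
  (ContinuousLinearMap.adjoint_inner_right _ _ _).symm

theorem inner_annihilate_left (n : ℕ) (u : E) (x : FermionSpace E (n + 1))
    (y : FermionSpace E n) : inner ℂ (annihilate n u x) y = inner ℂ x (create n u y) :=
  ContinuousLinearMap.adjoint_inner_left _ _ _

theorem annihilate_coe (n : ℕ) (u : E) (x : ⋀[ℂ]^(n + 1) E) :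
    annihilate n u (x : FermionSpace E (n + 1)) = (contractLeft n u x : FermionSpace E n) := by
  refine ext_inner_left ℂ fun v => ?_
  induction v using UniformSpace.Completion.induction_on with
  | hp => exact isClosed_eq (by fun_prop) (by fun_prop)
  | ih v =>
    rw [← inner_create_left, create_coe, UniformSpace.Completion.inner_coe,
      UniformSpace.Completion.inner_coe, inner_wedgeLeft]

theorem annihilate_create_zero (u v : E) (x : FermionSpace E 0) :
    annihilate 0 u (create 0 v x) = inner ℂ u v • x := by
  induction x using UniformSpace.Completion.induction_on with
  | hp => exact isClosed_eq (annihilate 0 u ∘L create 0 v).continuous (continuous_const_smul _)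
  | ih x =>
    rw [create_coe, annihilate_coe, contractLeft_wedgeLeft_zero, UniformSpace.Completion.coe_smul]

theorem annihilate_create_succ (n : ℕ) (u v : E) (x : FermionSpace E (n + 1)) :
    annihilate (n + 1) u (create (n + 1) v x) + create n v (annihilate n u x) =
      inner ℂ u v • x := by
  induction x using UniformSpace.Completion.induction_on with
  | hp =>
    exact isClosed_eq (annihilate (n + 1) u ∘L create (n + 1) v +
      create n v ∘L annihilate n u).continuous (continuous_const_smul _)
  | ih x =>
    rw [create_coe, annihilate_coe, annihilate_coe, create_coe, contractLeft_wedgeLeft_succ,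
      UniformSpace.Completion.coe_sub, UniformSpace.Completion.coe_smul, sub_add_cancel]

theorem wedgeLeft_wedgeLeft (n : ℕ) (u v : E) (x : ⋀[ℂ]^n E) :
    wedgeLeft (n + 1) u (wedgeLeft n v x) + wedgeLeft (n + 1) v (wedgeLeft n u x) = 0 := by
  have h : wedgeLeft (n + 1) u ∘ₗ wedgeLeft n v + wedgeLeft (n + 1) v ∘ₗ wedgeLeft n u = 0 := by
    refine linearMap_ext (AlternatingMap.ext fun y => ?_)
    simp only [LinearMap.compAlternatingMap_apply, LinearMap.add_apply, LinearMap.comp_apply,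
      wedgeLeft_ιMulti, LinearMap.zero_apply]
    have hs : Matrix.vecCons v (Matrix.vecCons u y) =
        Matrix.vecCons u (Matrix.vecCons v y) ∘ Equiv.swap 0 1 := by
      ext j
      refine Fin.cases ?_ (fun j => Fin.cases ?_ (fun j => ?_) j) j
      · simp
      · simp
      · rw [Function.comp_apply, Equiv.swap_apply_of_ne_of_ne (by simp)
          (by simp [Fin.ext_iff])]
        rfl
    rw [hs, AlternatingMap.map_swap _ _ (by simp), add_neg_cancel]
  exact LinearMap.congr_fun h x

theorem create_create (n : ℕ) (u v : E) (x : FermionSpace E n) :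
    create (n + 1) u (create n v x) + create (n + 1) v (create n u x) = 0 := by
  induction x using UniformSpace.Completion.induction_on with
  | hp => exact isClosed_eq (by fun_prop) (by fun_prop)
  | ih x =>
    rw [create_coe, create_coe, create_coe, create_coe, ← UniformSpace.Completion.coe_add,
      wedgeLeft_wedgeLeft, UniformSpace.Completion.coe_zero]

theorem annihilate_annihilate (n : ℕ) (u v : E) (x : FermionSpace E (n + 2)) :
    annihilate n u (annihilate (n + 1) v x) + annihilate n v (annihilate (n + 1) u x) = 0 := by
  refine ext_inner_left ℂ fun y => ?_
  rw [inner_add_right, ← inner_create_left, ← inner_create_left, ← inner_create_left,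
    ← inner_create_left, ← inner_add_left, create_create, inner_zero_left, inner_zero_right]

theorem norm_create_le (n : ℕ) (u : E) (x : FermionSpace E n) :
    ‖create n u x‖ ≤ ‖u‖ * ‖x‖ := by
  induction x using UniformSpace.Completion.induction_on with
  | hp => exact isClosed_le (by fun_prop) (by fun_prop)
  | ih x =>
    rw [create_coe, UniformSpace.Completion.norm_coe, UniformSpace.Completion.norm_coe]
    exact norm_wedgeLeft_le n u x

theorem norm_annihilate_le (n : ℕ) (u : E) (x : FermionSpace E (n + 1)) :
    ‖annihilate n u x‖ ≤ ‖u‖ * ‖x‖ := by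
  have h : ‖annihilate n u‖ ≤ ‖u‖ := by
    rw [annihilate, LinearIsometryEquiv.norm_map]
    exact ContinuousLinearMap.opNorm_le_bound _ (norm_nonneg u) (norm_create_le n u)
  exact (ContinuousLinearMap.le_opNorm _ _).trans (by gcongr)

/-- For fixed `y`, the map `u ↦ u ∧ y` into the completed exterior power. -/
def wedgeRight (n : ℕ) (y : ⋀[ℂ]^n E) : E →L[ℂ] FermionSpace E (n + 1) :=
  LinearMap.mkContinuous
    { toFun := fun u => (wedgeLeft n u y : FermionSpace E (n + 1))
      map_add' := fun u v => by
        rw [← UniformSpace.Completion.coe_add]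
        simp [wedgeLeft]
      map_smul' := fun c u => by
        rw [RingHom.id_apply, ← UniformSpace.Completion.coe_smul]
        simp [wedgeLeft] } ‖y‖
    fun u => by
      simpa [mul_comm] using norm_wedgeLeft_le n u y

theorem wedgeRight_apply (n : ℕ) (y : ⋀[ℂ]^n E) (u : E) :
    wedgeRight n y u = (wedgeLeft n u y : FermionSpace E (n + 1)) := rfl

/-- On exterior products, `∑ₐ c*(uₐ) c(uₐ)` is the particle number. -/
theorem hasSum_create_annihilate_ιMulti [CompleteSpace E] {ι : Type*} (b : HilbertBasis ι ℂ E)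
    (n : ℕ) (x : Fin (n + 1) → E) :
    HasSum (fun a => create n (b a) (annihilate n (b a)
        (ιMulti ℂ (n + 1) x : FermionSpace E (n + 1))))
      ((n + 1 : ℕ) • (ιMulti ℂ (n + 1) x : FermionSpace E (n + 1))) := by
  have h1 : ∀ i : Fin (n + 1), HasSum
      (fun a => (-1 : ℂ) ^ (i : ℕ) • wedgeRight n (ιMulti ℂ n (i.removeNth x))
        (inner ℂ (b a) (x i) • b a))
      ((-1 : ℂ) ^ (i : ℕ) • wedgeRight n (ιMulti ℂ n (i.removeNth x)) (x i)) := by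
    intro i
    refine HasSum.const_smul _ (ContinuousLinearMap.hasSum _ ?_)
    simpa only [b.repr_apply_apply] using b.hasSum_repr (x i)
  have h2 := hasSum_sum (s := Finset.univ) fun i _ => h1 i
  have h3 : ∀ i : Fin (n + 1), (-1 : ℂ) ^ (i : ℕ) •
      wedgeRight n (ιMulti ℂ n (i.removeNth x)) (x i) =
        (ιMulti ℂ (n + 1) x : FermionSpace E (n + 1)) := by
    -- Putting `x i` back at the front instead of in slot `i` costs `(-1)^i`, which cancels the sign
    -- of the contraction. Each of the `n + 1` slots thus reproduces the original product.
    intro i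
    have h4 : (ιMulti ℂ (n + 1)) (i.insertNth (x i) (i.removeNth x)) =
        (-1 : ℂ) ^ (i : ℕ) • (ιMulti ℂ (n + 1)) (Matrix.vecCons (x i) (i.removeNth x)) := by
      rw [AlternatingMap.map_insertNth]
      rcases Nat.even_or_odd (i : ℕ) with h | h <;> simp [h.neg_one_pow, Matrix.vecCons]
    rw [wedgeRight_apply, wedgeLeft_ιMulti, ← UniformSpace.Completion.coe_smul, ← h4,
      Fin.insertNth_self_removeNth]
  rw [Finset.sum_congr rfl fun i _ => h3 i, Finset.sum_const, Finset.card_univ,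
    Fintype.card_fin] at h2
  convert h2 using 2 with a
  rw [annihilate_coe, create_coe, contractLeft_ιMulti, map_sum]
  simp only [map_smul, wedgeRight_apply, ← UniformSpace.Completion.coe_smul]
  exact map_sum (UniformSpace.Completion.toComplL (𝕜 := ℂ) (E := ⋀[ℂ]^(n + 1) E)) _ _

theorem inner_sum_create_annihilate (n : ℕ) {ι : Type*} (b : ι → E) (F : Finset ι)
    (x y : FermionSpace E (n + 1)) :
    inner ℂ x (∑ a ∈ F, create n (b a) (annihilate n (b a) y)) =
      ∑ a ∈ F, inner ℂ (annihilate n (b a) x) (annihilate n (b a) y) := by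
  rw [inner_sum]
  simp only [inner_annihilate_left]

theorem hasSum_create_annihilate_coe [CompleteSpace E] {ι : Type*} (b : HilbertBasis ι ℂ E)
    (n : ℕ) (x : ⋀[ℂ]^(n + 1) E) :
    HasSum (fun a => create n (b a) (annihilate n (b a) (x : FermionSpace E (n + 1))))
      ((n + 1 : ℕ) • (x : FermionSpace E (n + 1))) := by
  have hx : x ∈ Submodule.span ℂ (Set.range (ιMulti ℂ (n + 1) (M := E))) := by
    rw [ιMulti_span]; trivial
  induction hx using Submodule.span_induction with
  | zero => simp only [UniformSpace.Completion.coe_zero, map_zero, smul_zero, hasSum_zero]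
  | add x y _ _ hx hy =>
    simpa only [UniformSpace.Completion.coe_add, map_add, smul_add] using hx.add hy
  | smul r x _ hx =>
    have := hx.const_smul r
    rw [smul_comm] at this
    simpa only [UniformSpace.Completion.coe_smul, map_smul] using this
  | mem a ha =>
    obtain ⟨a, rfl⟩ := ha
    exact hasSum_create_annihilate_ιMulti b n a

/-- On algebraic vectors the full sum of these nonnegative terms is the number operator tested on
`x`. A fixed finite partial sum is continuous in `x`, so the bound extends to the completion by
density. -/
theorem sum_norm_sq_annihilate_le [CompleteSpace E] {ι : Type*} (b : HilbertBasis ι ℂ E) (n : ℕ)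
    (F : Finset ι) (x : FermionSpace E (n + 1)) :
    ∑ a ∈ F, ‖annihilate n (b a) x‖ ^ 2 ≤ (n + 1 : ℕ) * ‖x‖ ^ 2 := by
  induction x using UniformSpace.Completion.induction_on with
  | hp => exact isClosed_le (by fun_prop) (by fun_prop)
  | ih x =>
    have h := Complex.hasSum_re
      ((innerSL ℂ (x : FermionSpace E (n + 1))).hasSum (hasSum_create_annihilate_coe b n x))
    simp only [innerSL_apply_apply, ← inner_annihilate_left] at h
    have h2 : (inner ℂ (x : FermionSpace E (n + 1))
        ((n + 1 : ℕ) • (x : FermionSpace E (n + 1)))).re =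
          (n + 1 : ℕ) * ‖(x : FermionSpace E (n + 1))‖ ^ 2 := by
      rw [← Nat.cast_smul_eq_nsmul ℂ, inner_smul_right, inner_self_eq_norm_sq_to_K]
      norm_cast
      exact (Complex.re_mul_ofReal _ _).trans (by rw [Complex.natCast_re]; rfl)
    rw [h2] at h
    refine le_trans (le_of_eq (Finset.sum_congr rfl fun a _ => ?_))
      (sum_le_hasSum F (fun a _ => ?_) h)
    · exact (inner_self_eq_norm_sq (𝕜 := ℂ) _).symm
    · exact inner_self_nonneg (𝕜 := ℂ)

/-- A bound uniform in `F`, needed to pass from algebraic vectors to the completion. Test the output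
`v` against itself, move each creation operator to the other side, and apply Cauchy–Schwarz. A
factor `‖v‖` then cancels. -/
theorem norm_sum_create_annihilate_le [CompleteSpace E] {ι : Type*} (b : HilbertBasis ι ℂ E)
    (n : ℕ) (F : Finset ι) (x : FermionSpace E (n + 1)) :
    ‖∑ a ∈ F, create n (b a) (annihilate n (b a) x)‖ ≤ (n + 1 : ℕ) * ‖x‖ := by
  set v := ∑ a ∈ F, create n (b a) (annihilate n (b a) x) with hv
  have h1 : ‖v‖ ^ 2 ≤ ∑ a ∈ F, ‖annihilate n (b a) v‖ * ‖annihilate n (b a) x‖ := by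
    rw [← inner_self_eq_norm_sq (𝕜 := ℂ)]
    conv_lhs => rw [hv, ← hv, hv, inner_sum_create_annihilate, ← hv, map_sum]
    exact Finset.sum_le_sum fun a _ => (RCLike.re_le_norm _).trans (norm_inner_le_norm _ _)
  have h2 := Finset.sum_mul_sq_le_sq_mul_sq F (fun a => ‖annihilate n (b a) v‖)
    (fun a => ‖annihilate n (b a) x‖)
  have h3 : (∑ a ∈ F, ‖annihilate n (b a) v‖ * ‖annihilate n (b a) x‖) ^ 2 ≤
      (‖v‖ * ((n + 1 : ℕ) * ‖x‖)) ^ 2 := by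
    refine h2.trans ((mul_le_mul (sum_norm_sq_annihilate_le b n F v)
      (sum_norm_sq_annihilate_le b n F x) (by positivity) (by positivity)).trans (le_of_eq ?_))
    ring
  have h4 := h1.trans (le_of_sq_le_sq h3 (by positivity))
  rcases (norm_nonneg v).eq_or_lt with h0 | h0
  · rw [← h0]; positivity
  · rw [sq] at h4
    exact le_of_mul_le_mul_left h4 h0

/-- `∑ₐ c*(uₐ) c(uₐ)` over an orthonormal basis is the particle number. -/
theorem hasSum_create_annihilate [CompleteSpace E] {ι : Type*} (b : HilbertBasis ι ℂ E) (n : ℕ)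
    (x : FermionSpace E (n + 1)) :
    HasSum (fun a => create n (b a) (annihilate n (b a) x)) ((n + 1 : ℕ) • x) := by
  rw [HasSum, Metric.tendsto_nhds]
  intro ε hε
  -- The error has three parts: `n + 1` times `δ` for replacing `x` by `y` in the partial sum, the
  -- same in the limit, and one `δ` for convergence at `y`.
  set δ := ε / (2 * (n + 1 : ℕ) + 1) with hδ
  have hδ0 : 0 < δ := by positivity
  obtain ⟨y, hy⟩ := UniformSpace.Completion.denseRange_coe.exists_dist_lt x hδ0
  have hc := hasSum_create_annihilate_coe b n y
  rw [HasSum, Metric.tendsto_nhds] at hc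
  filter_upwards [hc δ hδ0] with F hF
  rw [SummationFilter.unconditional_filter] at *
  rw [dist_eq_norm] at hF hy ⊢
  set S : FermionSpace E (n + 1) → FermionSpace E (n + 1) := fun z =>
    ∑ a ∈ F, create n (b a) (annihilate n (b a) z) with hS
  have hsub : S (x - y) = S x - S y := by simp [hS]
  have e : S x - (n + 1 : ℕ) • x =
      S (x - y) + (S y - (n + 1 : ℕ) • (y : FermionSpace E (n + 1))) - (n + 1 : ℕ) • (x - y) := by
    rw [hsub, smul_sub]; abel
  have hle := norm_sum_create_annihilate_le b n F (x - y)
  have hn : ‖(n + 1 : ℕ) • (x - (y : FermionSpace E (n + 1)))‖ ≤ (n + 1 : ℕ) * ‖x - y‖ :=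
    norm_nsmul_le
  have hlt : (n + 1 : ℕ) * ‖x - y‖ ≤ (n + 1 : ℕ) * δ := by gcongr
  have hsum : ε = (2 * (n + 1 : ℕ) + 1) * δ := by rw [hδ]; field_simp
  calc ‖S x - (n + 1 : ℕ) • x‖ ≤ _ := by rw [e]; exact norm_sub_le _ _
    _ ≤ _ := add_le_add_left (norm_add_le _ _) _
    _ < ε := by
      change ‖S y - _‖ < δ at hF
      change ‖S (x - y)‖ ≤ _ at hle
      linarith

end SectorAlgebra
-- Fock space, where creation and annihilation are bounded operators in one star-algebra.
noncomputable section FockSpace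

variable {E : Type*} [NormedAddCommGroup E] [InnerProductSpace ℂ E]

variable (E) in
/-- The fermionic Fock space. -/
abbrev FockSpace : Type _ := lp (fun n => FermionSpace E n) 2

/-- The inclusion of the `n`-particle sector. -/
def sector (n : ℕ) : FermionSpace E n →ₗᵢ[ℂ] FockSpace E where
  toLinearMap := lp.lsingle 2 n
  norm_map' x := lp.norm_single (by norm_num) n x

theorem sector_apply (n : ℕ) (x : FermionSpace E n) (m : ℕ) :
    sector n x m = (Pi.single n x : ∀ m, FermionSpace E m) m := rfl

theorem inner_sector_left (n : ℕ) (x : FermionSpace E n) (f : FockSpace E) :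
    inner ℂ (sector n x) f = inner ℂ x (f n) :=
  lp.inner_single_left n x f

/-- The annihilation operator on Fock space. -/
def fockAnnihilate (u : E) : FockSpace E →L[ℂ] FockSpace E :=
  LinearMap.mkContinuous
    { toFun := fun f => ⟨fun n => annihilate n u (f (n + 1)), by
        have hf := (lp.memℓp f).summable (by norm_num : 0 < (2 : ENNReal).toReal)
        refine memℓp_gen ?_
        have h := ((summable_nat_add_iff 1).mpr hf).mul_left (‖u‖ ^ (2 : ENNReal).toReal)
        refine h.of_nonneg_of_le (fun n => by positivity) fun n => ?_
        rw [← Real.mul_rpow (norm_nonneg _) (norm_nonneg _)]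
        exact Real.rpow_le_rpow (norm_nonneg _) (norm_annihilate_le n u _) (by norm_num)⟩
      map_add' := fun f g => by ext n; exact map_add _ _ _
      map_smul' := fun c f => by ext n; simp } ‖u‖
    fun f => by
      refine lp.norm_le_of_forall_sum_le (by norm_num) (by positivity) fun s => ?_
      have h : ∀ n, ‖annihilate n u (f (n + 1))‖ ^ (2 : ENNReal).toReal ≤
          ‖u‖ ^ (2 : ENNReal).toReal * ‖f (n + 1)‖ ^ (2 : ENNReal).toReal := fun n => by
        rw [← Real.mul_rpow (norm_nonneg _) (norm_nonneg _)]
        exact Real.rpow_le_rpow (norm_nonneg _) (norm_annihilate_le n u _) (by norm_num)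
      refine (Finset.sum_le_sum fun n _ => h n).trans ?_
      rw [← Finset.mul_sum, Real.mul_rpow (norm_nonneg _) (norm_nonneg _)]
      refine mul_le_mul_of_nonneg_left ?_ (by positivity)
      have := lp.sum_rpow_le_norm_rpow (by norm_num : 0 < (2 : ENNReal).toReal) f
        (s.map (addRightEmbedding 1))
      rwa [Finset.sum_map] at this

theorem fockAnnihilate_apply (u : E) (f : FockSpace E) (n : ℕ) :
    fockAnnihilate u f n = annihilate n u (f (n + 1)) := rfl

/-- The creation operator on Fock space. -/
def fockCreate (u : E) : FockSpace E →L[ℂ] FockSpace E :=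
  ContinuousLinearMap.adjoint (fockAnnihilate u)

theorem fockAnnihilate_sector_zero (u : E) (x : FermionSpace E 0) :
    fockAnnihilate u (sector 0 x) = 0 := by
  ext n
  rw [fockAnnihilate_apply, sector_apply, Pi.single_eq_of_ne (by simp), map_zero]
  rfl

theorem fockAnnihilate_sector_succ (u : E) (n : ℕ) (x : FermionSpace E (n + 1)) :
    fockAnnihilate u (sector (n + 1) x) = sector n (annihilate n u x) := by
  ext m
  rw [fockAnnihilate_apply, sector_apply, sector_apply]
  by_cases h : m = n
  · subst h; simp
  · rw [Pi.single_eq_of_ne (by simpa using h), Pi.single_eq_of_ne h, map_zero]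

theorem fockCreate_apply_zero (u : E) (f : FockSpace E) : fockCreate u f 0 = 0 := by
  refine ext_inner_left ℂ fun y => ?_
  rw [← inner_sector_left, fockCreate, ContinuousLinearMap.adjoint_inner_right,
    fockAnnihilate_sector_zero, inner_zero_left, inner_zero_right]

theorem fockCreate_apply_succ (u : E) (f : FockSpace E) (n : ℕ) :
    fockCreate u f (n + 1) = create n u (f n) := by
  refine ext_inner_left ℂ fun y => ?_
  rw [← inner_sector_left, fockCreate, ContinuousLinearMap.adjoint_inner_right,
    fockAnnihilate_sector_succ, inner_sector_left, inner_annihilate_left]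

theorem fockCreate_sector (u : E) (n : ℕ) (x : FermionSpace E n) :
    fockCreate u (sector n x) = sector (n + 1) (create n u x) := by
  ext m
  cases m with
  | zero => rw [fockCreate_apply_zero, sector_apply, Pi.single_eq_of_ne (by simp)]
  | succ m =>
    rw [fockCreate_apply_succ, sector_apply, sector_apply]
    by_cases h : m = n
    · subst h; simp
    · rw [Pi.single_eq_of_ne h, Pi.single_eq_of_ne (by simpa using h), map_zero]

theorem star_fockAnnihilate (u : E) : star (fockAnnihilate u) = fockCreate u := rfl

theorem star_fockCreate (u : E) : star (fockCreate u) = fockAnnihilate u := by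
  rw [← star_fockAnnihilate, star_star]

theorem fockAnnihilate_mul_fockAnnihilate (u v : E) :
    fockAnnihilate u * fockAnnihilate v + fockAnnihilate v * fockAnnihilate u = 0 := by
  ext f n
  exact annihilate_annihilate n u v (f (n + 2))

theorem fockCreate_mul_fockCreate (u v : E) :
    fockCreate u * fockCreate v + fockCreate v * fockCreate u = 0 := by
  rw [← star_fockAnnihilate, ← star_fockAnnihilate, ← star_mul, ← star_mul, ← star_add,
    fockAnnihilate_mul_fockAnnihilate, star_zero]

theorem fockAnnihilate_mul_fockCreate (u v : E) :
    fockAnnihilate u * fockCreate v + fockCreate v * fockAnnihilate u =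
      (inner ℂ u v : ℂ) • (1 : FockSpace E →L[ℂ] FockSpace E) := by
  ext f n
  change fockAnnihilate u (fockCreate v f) n + fockCreate v (fockAnnihilate u f) n =
    inner ℂ u v • f n
  rw [fockAnnihilate_apply, fockCreate_apply_succ]
  cases n with
  | zero => rw [fockCreate_apply_zero, add_zero, annihilate_create_zero]
  | succ n => rw [fockCreate_apply_succ, fockAnnihilate_apply, annihilate_create_succ]

/-- The bridge back to `ℋ_N`: hopping operators preserve the sector, whereas the cubic operators
used below only make sense on Fock space. -/
theorem fockCreate_fockAnnihilate_sector (u v : E) (n : ℕ) (x : FermionSpace E n) :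
    fockCreate u (fockAnnihilate v (sector n x)) = sector n (createAnnihilate u v n x) := by
  cases n with
  | zero => rw [fockAnnihilate_sector_zero]; simp [createAnnihilate]
  | succ n => rw [fockAnnihilate_sector_succ, fockCreate_sector]; rfl

theorem hasSum_createAnnihilate [CompleteSpace E] {ι : Type*} (b : HilbertBasis ι ℂ E) (n : ℕ)
    (x : FermionSpace E n) : HasSum (fun a => createAnnihilate (b a) (b a) n x) (n • x) := by
  cases n with
  | zero => simp [createAnnihilate, hasSum_zero]
  | succ n => exact hasSum_create_annihilate b n x

end FockSpace
-- Normal-ordering identities from the anticommutation relations.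
section Algebra

set_option linter.unusedSectionVars false

variable {A X Y : Type*} [Ring A] [StarRing A] [Algebra ℂ A] [StarModule ℂ A]
  [Fintype X] [Fintype Y] [DecidableEq X] [DecidableEq Y]

/-- The canonical anticommutation relations for a family `c` of annihilation operators. -/
structure IsCAR (c : X → A) : Prop where
  anticomm : ∀ i j, c i * c j + c j * c i = 0
  anticomm_star : ∀ i j, c i * star (c j) + star (c j) * c i = if i = j then 1 else 0

/-- The pair operator `½ ∑ F(y, z) h_y h_z`. -/
noncomputable def pairOp (h : Y → A) (F : Y → Y → ℂ) : A :=
  ∑ y, ∑ z, (1 / 2 * F y z) • (h y * h z)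

/-- The operator `∑ g(z) h_z`. -/
def smear (h : Y → A) (g : Y → ℂ) : A := ∑ z, g z • h z

theorem star_smear (h : Y → A) (g : Y → ℂ) :
    star (smear h g) = ∑ z, star (g z) • star (h z) := by
  simp [smear, star_sum]

theorem star_pairOp (h : Y → A) (F : Y → Y → ℂ) :
    star (pairOp h F) = ∑ y, ∑ z, (1 / 2 * star (F y z)) • (star (h z) * star (h y)) := by
  simp [pairOp, star_sum]

theorem IsCAR.mul_star_smear {h : Y → A} (hh : IsCAR h) (w : Y) (g : Y → ℂ) :
    h w * star (smear h g) = star (g w) • 1 - star (smear h g) * h w := by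
  rw [eq_sub_iff_add_eq, star_smear, Finset.mul_sum, Finset.sum_mul, ← Finset.sum_add_distrib]
  simp only [mul_smul_comm, smul_mul_assoc, ← smul_add, hh.anticomm_star]
  simp

theorem IsCAR.smear_mul_star_smear {h : Y → A} (hh : IsCAR h) (g : Y → ℂ) :
    smear h g * star (smear h g) + star (smear h g) * smear h g =
      (∑ y, g y * star (g y)) • (1 : A) := by
  have h1 : ∀ S : A, smear h g * S + S * smear h g = ∑ y, g y • (h y * S + S * h y) := by
    intro S
    simp only [smear, Finset.sum_mul, Finset.mul_sum, ← Finset.sum_add_distrib, smul_mul_assoc,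
      mul_smul_comm, smul_add]
  rw [h1, Finset.sum_smul]
  refine Finset.sum_congr rfl fun y _ => ?_
  rw [hh.mul_star_smear, sub_add_cancel, smul_smul]

theorem IsCAR.mul_star_mul_star {h : Y → A} (hh : IsCAR h) (w y z : Y) :
    h w * (star (h z) * star (h y)) = star (h z) * star (h y) * h w +
      ((if w = z then star (h y) else 0) - (if w = y then star (h z) else 0)) := by
  have h1 := eq_sub_of_add_eq (hh.anticomm_star w z)
  have h2 := eq_sub_of_add_eq (hh.anticomm_star w y)
  rw [← mul_assoc, h1, sub_mul, mul_assoc (star (h z)), h2, mul_sub, ← mul_assoc]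
  split_ifs <;> simp <;> abel

/-- Passing `h_w` through a product of two adjoints produces two contractions of opposite sign.
Antisymmetry of `F` makes them equal, which removes the factor `1/2`. -/
theorem IsCAR.mul_star_pairOp {h : Y → A} (hh : IsCAR h) {F : Y → Y → ℂ}
    (hF : ∀ y z, F z y = -F y z) (w : Y) :
    h w * star (pairOp h F) = star (pairOp h F) * h w - star (smear h (F w)) := by
  rw [star_pairOp, star_smear]
  simp only [Finset.mul_sum, Finset.sum_mul, mul_smul_comm, smul_mul_assoc,
    hh.mul_star_mul_star, smul_add, smul_sub, Finset.sum_add_distrib, Finset.sum_sub_distrib]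
  rw [sub_eq_add_neg]
  have e1 : ∑ y, ∑ z, (1 / 2 * star (F y z)) • (if w = z then star (h y) else 0) =
      ∑ y, -((1 / 2 * star (F w y)) • star (h y)) := by
    refine Finset.sum_congr rfl fun y _ => ?_
    simp [hF w y]
  have e2 : ∑ y, ∑ z, (1 / 2 * star (F y z)) • (if w = y then star (h z) else 0) =
      ∑ z, (1 / 2 * star (F w z)) • star (h z) := by
    rw [Finset.sum_comm]
    refine Finset.sum_congr rfl fun y _ => ?_
    simp
  have e3 : ∑ z, star (F w z) • star (h z) = ∑ z, (1 / 2 * star (F w z)) • star (h z) +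
      ∑ z, (1 / 2 * star (F w z)) • star (h z) := by
    rw [← Finset.sum_add_distrib]
    refine Finset.sum_congr rfl fun z _ => ?_
    module
  rw [e1, e2, e3, Finset.sum_neg_distrib]
  abel

/-- Wick's theorem for two pair operators: no contraction, one contraction and two contractions. The
single contractions enter with a minus sign, and this sign decides below which terms may be dropped.
-/
theorem IsCAR.pairOp_mul_star_pairOp {h : Y → A} (hh : IsCAR h) {F G : Y → Y → ℂ}
    (hF : ∀ y z, F z y = -F y z) (hG : ∀ y z, G z y = -G y z) :
    pairOp h F * star (pairOp h G) = star (pairOp h G) * pairOp h F -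
      ∑ y, star (smear h (G y)) * smear h (F y) +
      (1 / 2 * ∑ y, ∑ z, F y z * star (G y z)) • (1 : A) := by
  have h1 : ∀ y z, h y * h z * star (pairOp h G) = star (pairOp h G) * (h y * h z) -
      star (smear h (G y)) * h z + star (smear h (G z)) * h y + star (G y z) • 1 := by
    intro y z
    rw [mul_assoc, hh.mul_star_pairOp hG, mul_sub, ← mul_assoc, hh.mul_star_pairOp hG,
      hh.mul_star_smear, hG y z, star_neg, neg_smul, sub_mul, mul_assoc]
    abel
  have h2 : pairOp h F * star (pairOp h G) = ∑ y, ∑ z, (1 / 2 * F y z) •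
      (star (pairOp h G) * (h y * h z) - star (smear h (G y)) * h z +
        star (smear h (G z)) * h y + star (G y z) • 1) := by
    conv_lhs => enter [1]; rw [pairOp]
    simp only [Finset.sum_mul, smul_mul_assoc, h1]
  rw [h2]
  simp only [smul_add, smul_sub, Finset.sum_add_distrib, Finset.sum_sub_distrib]
  have e1 : ∑ y, ∑ z, (1 / 2 * F y z) • (star (pairOp h G) * (h y * h z)) =
      star (pairOp h G) * pairOp h F := by
    conv_rhs => enter [2]; rw [pairOp]
    simp only [Finset.mul_sum, mul_smul_comm]
  have e2 : ∑ y, ∑ z, (1 / 2 * F y z) • (star (smear h (G y)) * h z) =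
      (1 / 2 : ℂ) • ∑ y, star (smear h (G y)) * smear h (F y) := by
    rw [Finset.smul_sum]
    refine Finset.sum_congr rfl fun y _ => ?_
    conv_rhs => enter [2, 2]; rw [smear]
    simp only [Finset.mul_sum, Finset.smul_sum, mul_smul_comm, smul_smul]
  have e3 : ∑ y, ∑ z, (1 / 2 * F y z) • (star (smear h (G z)) * h y) =
      -((1 / 2 : ℂ) • ∑ y, star (smear h (G y)) * smear h (F y)) := by
    rw [Finset.sum_comm, ← e2, ← Finset.sum_neg_distrib]
    refine Finset.sum_congr rfl fun y _ => ?_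
    rw [← Finset.sum_neg_distrib]
    refine Finset.sum_congr rfl fun z _ => ?_
    rw [hF y z, mul_neg, neg_smul]
  have e4 : ∑ y, ∑ z, (1 / 2 * F y z) • (star (G y z) • (1 : A)) =
      (1 / 2 * ∑ y, ∑ z, F y z * star (G y z)) • (1 : A) := by
    simp only [Finset.mul_sum, Finset.sum_smul, smul_smul, mul_assoc]
  rw [e1, e2, e3, e4]
  module

/-- The triple operator `½ ∑ F(x, y, z) a_x h_y h_z`. -/
noncomputable def tripleOp (a : X → A) (h : Y → A) (F : X → Y → Y → ℂ) : A :=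
  ∑ x, a x * pairOp h (F x)

theorem commute_pairOp {h : Y → A} {b : A} (hb : ∀ y, b * h y + h y * b = 0) (F : Y → Y → ℂ) :
    Commute b (pairOp h F) := by
  refine Commute.sum_right _ _ _ fun y _ => Commute.sum_right _ _ _ fun z _ =>
    Commute.smul_right ?_ _
  have h1 := eq_neg_of_add_eq_zero_left (hb y)
  have h2 := eq_neg_of_add_eq_zero_left (hb z)
  rw [Commute, SemiconjBy, ← mul_assoc, h1, neg_mul, mul_assoc, h2, mul_neg, neg_neg, mul_assoc]

/-- Write the operator as `∑ D_x a_x`, where each `a_x` commutes with every `D` and `D*`.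
Contracting the `a`'s leaves `∑ D_x D_x*` minus `∑ a*_{x'} D_x D*_{x'} a_x`, and the `D`'s are then
normal ordered. The sextic term is minus the reversed product, so it joins the left side. So do the
other negative terms, which are squares; only the right side will need estimating. -/
theorem tripleOp_identity {a : X → A} {h : Y → A} (ha : IsCAR a) (hh : IsCAR h)
    (hah : ∀ x y, a x * h y + h y * a x = 0)
    (hah' : ∀ x y, a x * star (h y) + star (h y) * a x = 0)
    {F : X → Y → Y → ℂ} (hF : ∀ x y z, F x z y = -F x y z) :
    tripleOp a h F * star (tripleOp a h F) + star (tripleOp a h F) * tripleOp a h F +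
      ∑ x, ∑ y, star (smear h (F x y)) * smear h (F x y) +
      (1 / 2 : ℂ) • ∑ y, ∑ z, star (smear a fun x => F x y z) * smear a (fun x => F x y z) =
    ∑ x, star (pairOp h (F x)) * pairOp h (F x) +
      ∑ y, star (∑ x, smear h (F x y) * a x) * (∑ x, smear h (F x y) * a x) +
      (1 / 2 * ∑ x, ∑ y, ∑ z, F x y z * star (F x y z)) • (1 : A) := by
  set D : X → A := fun x => pairOp h (F x) with hD
  have c1 : ∀ x x', a x * D x' = D x' * a x := fun x x' => commute_pairOp (hah x) _
  -- Taking adjoints turns this into `star (a x)` commuting with a product of two `h`'s, past each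
  -- of which it anticommutes.
  have c2 : ∀ x x', a x * star (D x') = star (D x') * a x := fun x x' => by
    have hb : ∀ y, star (a x) * h y + h y * star (a x) = 0 := fun y => by
      have := congrArg star (hah' x y)
      rwa [star_add, star_mul, star_mul, star_star, star_zero, add_comm] at this
    have := congrArg star (commute_pairOp hb (F x')).eq
    rw [star_mul, star_mul, star_star] at this
    exact this.symm
  have hT : tripleOp a h F = ∑ x, D x * a x := Finset.sum_congr rfl fun x _ => c1 x x
  have hT' : star (tripleOp a h F) = ∑ x, star (a x) * star (D x) := by
    simp only [hT, star_sum, star_mul]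
  have key : ∀ x x', D x * a x * (star (a x') * star (D x')) =
      (if x = x' then D x * star (D x') else 0) - star (a x') * (D x * star (D x')) * a x := by
    intro x x'
    have c3 : star (a x') * D x = D x * star (a x') := by
      have := congrArg star (c2 x' x)
      rw [star_mul, star_mul, star_star] at this
      exact this.symm
    have h1 := eq_sub_of_add_eq (ha.anticomm_star x x')
    rw [mul_assoc, ← mul_assoc (a x), h1, sub_mul, mul_sub, ite_mul, one_mul, zero_mul, mul_ite,
      mul_zero]
    congr 1
    rw [mul_assoc (star (a x')) (a x), c2 x x', ← mul_assoc, ← c3]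
    simp only [mul_assoc]
  have hTT : tripleOp a h F * star (tripleOp a h F) =
      ∑ x, D x * star (D x) - ∑ x, ∑ x', star (a x') * (D x * star (D x')) * a x := by
    rw [hT', hT, Finset.sum_mul_sum]
    simp only [key, Finset.sum_sub_distrib]
    simp
  have hP : ∀ x x', D x * star (D x') = star (D x') * D x -
      ∑ y, star (smear h (F x' y)) * smear h (F x y) +
      (1 / 2 * ∑ y, ∑ z, F x y z * star (F x' y z)) • (1 : A) := fun x x' =>
    hh.pairOp_mul_star_pairOp (hF x) (hF x')
  have e1 : ∑ x, ∑ x', star (a x') * (star (D x') * D x) * a x =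
      star (tripleOp a h F) * tripleOp a h F := by
    rw [hT', hT, Finset.sum_mul_sum, Finset.sum_comm]
    simp only [mul_assoc]
  have e2 : ∑ x, ∑ x', star (a x') * (∑ y, star (smear h (F x' y)) * smear h (F x y)) * a x =
      ∑ y, star (∑ x, smear h (F x y) * a x) * (∑ x, smear h (F x y) * a x) := by
    simp only [star_sum, star_mul, Finset.mul_sum, Finset.sum_mul]
    simp only [Finset.sum_comm (γ := Y), mul_assoc]
  have e3 : ∑ x, ∑ x', star (a x') * ((1 / 2 * ∑ y, ∑ z, F x y z * star (F x' y z)) • (1 : A)) *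
      a x = (1 / 2 : ℂ) • ∑ y, ∑ z, star (smear a fun x => F x y z) *
        smear a (fun x => F x y z) := by
    have hc : ∀ f : Y → Y → X → A, ∑ y, ∑ z, ∑ x, f y z x = ∑ x, ∑ y, ∑ z, f y z x := fun f =>
      (Finset.sum_congr rfl fun y _ => Finset.sum_comm).trans Finset.sum_comm
    simp only [star_smear]
    simp only [smear, Finset.sum_mul_sum, Finset.smul_sum]
    rw [hc, Finset.sum_comm]
    refine Finset.sum_congr rfl fun x' _ => ?_
    rw [hc]
    refine Finset.sum_congr rfl fun x _ => ?_
    simp only [mul_smul_comm, smul_mul_assoc, mul_one, Finset.mul_sum, Finset.sum_smul,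
      Finset.sum_mul]
    refine Finset.sum_congr rfl fun y _ => Finset.sum_congr rfl fun z _ => ?_
    module
  rw [hTT]
  simp only [hP, mul_add, mul_sub, add_mul, sub_mul, Finset.sum_add_distrib,
    Finset.sum_sub_distrib, e1, e2, e3]
  rw [← Finset.sum_smul, ← Finset.mul_sum]
  abel

end Algebra
-- Norm estimates for linear, pair, cubic and quartic operators.
section Bounds

set_option linter.unusedSectionVars false

variable {H X Y Z : Type*} [NormedAddCommGroup H] [InnerProductSpace ℂ H] [CompleteSpace H]
  [Fintype X] [Fintype Y] [Fintype Z] [DecidableEq X] [DecidableEq Y]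

/-- The quadratic form `T ↦ Re ⟨φ, T φ⟩`. -/
noncomputable def reForm (φ : H) : (H →L[ℂ] H) →+ ℝ where
  toFun T := (inner ℂ φ (T φ)).re
  map_zero' := by simp
  map_add' S T := by rw [add_apply, inner_add_right, Complex.add_re]

theorem reForm_star_mul_self (T : H →L[ℂ] H) (φ : H) : reForm φ (star T * T) = ‖T φ‖ ^ 2 := by
  change RCLike.re (inner ℂ φ (ContinuousLinearMap.adjoint T (T φ))) = _
  rw [ContinuousLinearMap.adjoint_inner_right, inner_self_eq_norm_sq]

theorem reForm_mul_star_self (T : H →L[ℂ] H) (φ : H) :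
    reForm φ (T * star T) = ‖star T φ‖ ^ 2 := by
  rw [← reForm_star_mul_self, star_star]

theorem reForm_smul (r : ℝ) (T : H →L[ℂ] H) (φ : H) :
    reForm φ ((r : ℂ) • T) = r * reForm φ T := by
  change (inner ℂ φ ((r : ℂ) • T φ)).re = _
  rw [inner_smul_right, Complex.re_ofReal_mul]
  rfl

theorem reForm_one (φ : H) : reForm φ (1 : H →L[ℂ] H) = ‖φ‖ ^ 2 :=
  inner_self_eq_norm_sq (𝕜 := ℂ) φ

theorem mul_star_eq_norm_sq (z : ℂ) : z * star z = ((‖z‖ ^ 2 : ℝ) : ℂ) := by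
  rw [Complex.ofReal_pow]
  exact Complex.mul_conj' z

/-- The squares of a smeared operator and of its adjoint add up to the scalar `∑ ‖g z‖²`, and the
adjoint's share is dropped. No number operator is needed. -/
theorem IsCAR.norm_smear_sq_le {h : Y → H →L[ℂ] H} (hh : IsCAR h) (g : Y → ℂ) (φ : H) :
    ‖smear h g φ‖ ^ 2 ≤ (∑ z, ‖g z‖ ^ 2) * ‖φ‖ ^ 2 := by
  have h1 := congrArg (reForm φ) (hh.smear_mul_star_smear g)
  simp only [mul_star_eq_norm_sq, ← Complex.ofReal_sum, map_add, reForm_smul, reForm_one,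
    reForm_star_mul_self, reForm_mul_star_self] at h1
  linarith [sq_nonneg ‖star (smear h g) φ‖]

theorem IsCAR.norm_sum_smear_mul_sq_le {h : Y → H →L[ℂ] H} (hh : IsCAR h) (g : Z → Y → ℂ)
    (d : Z → H →L[ℂ] H) (φ : H) :
    ‖(∑ i, smear h (g i) * d i) φ‖ ^ 2 ≤ (∑ i, ∑ z, ‖g i z‖ ^ 2) * ∑ i, ‖d i φ‖ ^ 2 := by
  have h1 : ∀ i, ‖smear h (g i) (d i φ)‖ ≤ √(∑ z, ‖g i z‖ ^ 2) * ‖d i φ‖ := fun i => by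
    refine le_of_sq_le_sq ?_ (by positivity)
    rw [mul_pow, Real.sq_sqrt (by positivity)]
    exact hh.norm_smear_sq_le (g i) (d i φ)
  have h2 : ‖(∑ i, smear h (g i) * d i) φ‖ ≤ ∑ i, √(∑ z, ‖g i z‖ ^ 2) * ‖d i φ‖ := by
    rw [sum_apply]
    exact (norm_sum_le _ _).trans (Finset.sum_le_sum fun i _ => h1 i)
  refine (pow_le_pow_left₀ (norm_nonneg _) h2 2).trans
    ((Finset.sum_mul_sq_le_sq_mul_sq _ _ _).trans (le_of_eq ?_))
  congr 1
  exact Finset.sum_congr rfl fun i _ => Real.sq_sqrt (by positivity)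

theorem pairOp_eq_sum_smear_mul (h : Y → H →L[ℂ] H) (F : Y → Y → ℂ) :
    pairOp h F = ∑ z, smear h (fun y => 1 / 2 * F y z) * h z := by
  rw [pairOp, Finset.sum_comm]
  simp only [smear, Finset.sum_mul, smul_mul_assoc]

/-- Only the rightmost `h` is charged to the number of holes; the other is absorbed in a bounded
smeared operator. Hence the growth is linear rather than quadratic in that number, and the `1/4` is
the square of the `1/2` in `pairOp`. -/
theorem IsCAR.norm_pairOp_sq_le {h : Y → H →L[ℂ] H} (hh : IsCAR h) (F : Y → Y → ℂ) (φ : H) :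
    ‖pairOp h F φ‖ ^ 2 ≤ (1 / 4 * ∑ y, ∑ z, ‖F y z‖ ^ 2) * ∑ y, ‖h y φ‖ ^ 2 := by
  rw [pairOp_eq_sum_smear_mul]
  refine (hh.norm_sum_smear_mul_sq_le _ _ φ).trans (le_of_eq ?_)
  congr 1
  rw [Finset.sum_comm]
  simp only [Finset.mul_sum, norm_mul, mul_pow]
  norm_num

/-- Take expectations in `tripleOp_identity` and discard the three other nonnegative terms on its
left. The three terms on its right give the coefficients `1/4`, `1` and `1/2`. -/
theorem norm_star_tripleOp_sq_le {a : X → H →L[ℂ] H} {h : Y → H →L[ℂ] H}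
    (ha : IsCAR a) (hh : IsCAR h) (hah : ∀ x y, a x * h y + h y * a x = 0)
    (hah' : ∀ x y, a x * star (h y) + star (h y) * a x = 0)
    {F : X → Y → Y → ℂ} (hF : ∀ x y z, F x z y = -F x y z) (φ : H) :
    ‖star (tripleOp a h F) φ‖ ^ 2 ≤ (∑ x, ∑ y, ∑ z, ‖F x y z‖ ^ 2) *
      (1 / 4 * ∑ y, ‖h y φ‖ ^ 2 + ∑ x, ‖a x φ‖ ^ 2 + 1 / 2 * ‖φ‖ ^ 2) := by
  have h1 := congrArg (reForm φ) (tripleOp_identity ha hh hah hah' hF)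
  have hhalf : (1 / 2 : ℂ) = ((1 / 2 : ℝ) : ℂ) := by norm_num
  simp only [mul_star_eq_norm_sq, ← Complex.ofReal_sum, hhalf, ← Complex.ofReal_mul, map_add,
    map_sum, reForm_smul, reForm_one, reForm_star_mul_self, reForm_mul_star_self] at h1
  have hD : ∑ x, ‖pairOp h (F x) φ‖ ^ 2 ≤
      1 / 4 * (∑ x, ∑ y, ∑ z, ‖F x y z‖ ^ 2) * ∑ y, ‖h y φ‖ ^ 2 := by
    refine (Finset.sum_le_sum fun x _ => hh.norm_pairOp_sq_le (F x) φ).trans (le_of_eq ?_)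
    rw [← Finset.sum_mul, ← Finset.mul_sum]
  have hE : ∑ y, ‖(∑ x, smear h (F x y) * a x) φ‖ ^ 2 ≤
      (∑ x, ∑ y, ∑ z, ‖F x y z‖ ^ 2) * ∑ x, ‖a x φ‖ ^ 2 := by
    refine (Finset.sum_le_sum fun y _ =>
      hh.norm_sum_smear_mul_sq_le (fun x => F x y) a φ).trans (le_of_eq ?_)
    rw [← Finset.sum_mul, Finset.sum_comm]
  have p1 : 0 ≤ ‖tripleOp a h F φ‖ ^ 2 := sq_nonneg _
  have p2 : 0 ≤ ∑ x, ∑ y, ‖smear h (F x y) φ‖ ^ 2 :=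
    Finset.sum_nonneg fun _ _ => Finset.sum_nonneg fun _ _ => sq_nonneg _
  have p3 : 0 ≤ ∑ y, ∑ z, ‖smear a (fun x => F x y z) φ‖ ^ 2 :=
    Finset.sum_nonneg fun _ _ => Finset.sum_nonneg fun _ _ => sq_nonneg _
  linarith

/-- `∑ f(x, y, z) h_z* h_y* a_x*` is bounded by `√5 ‖f‖ (𝒩 + 1)^{1/2}`. -/
theorem norm_star_triple_sq_le {a : X → H →L[ℂ] H} {h : Y → H →L[ℂ] H}
    (ha : IsCAR a) (hh : IsCAR h) (hah : ∀ x y, a x * h y + h y * a x = 0)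
    (hah' : ∀ x y, a x * star (h y) + star (h y) * a x = 0)
    (f : X → Y → Y → ℂ) (φ : H) {M : ℝ} (hM : ∑ x, ‖a x φ‖ ^ 2 ≤ M)
    (hM' : ∑ y, ‖h y φ‖ ^ 2 ≤ M) :
    ‖star (∑ x, ∑ y, ∑ z, f x y z • (a x * h y * h z)) φ‖ ^ 2 ≤
      5 * (∑ x, ∑ y, ∑ z, ‖f x y z‖ ^ 2) * (M + ‖φ‖ ^ 2) := by
  set F : X → Y → Y → ℂ := fun x y z => f x y z - f x z y with hF
  have hT : ∑ x, ∑ y, ∑ z, f x y z • (a x * h y * h z) = tripleOp a h F := by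
    refine Finset.sum_congr rfl fun x _ => ?_
    have e : ∑ y, ∑ z, f x z y • (h y * h z) = -∑ y, ∑ z, f x y z • (h y * h z) := by
      rw [Finset.sum_comm, ← Finset.sum_neg_distrib]
      refine Finset.sum_congr rfl fun y _ => ?_
      rw [← Finset.sum_neg_distrib]
      refine Finset.sum_congr rfl fun z _ => ?_
      rw [eq_neg_of_add_eq_zero_left (hh.anticomm z y), smul_neg]
    have e2 : pairOp h (F x) = ∑ y, ∑ z, f x y z • (h y * h z) := by
      have : pairOp h (F x) = (1 / 2 : ℂ) • (∑ y, ∑ z, f x y z • (h y * h z) -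
          ∑ y, ∑ z, f x z y • (h y * h z)) := by
        rw [pairOp, ← Finset.sum_sub_distrib, Finset.smul_sum]
        refine Finset.sum_congr rfl fun y _ => ?_
        rw [← Finset.sum_sub_distrib, Finset.smul_sum]
        refine Finset.sum_congr rfl fun z _ => ?_
        rw [← sub_smul, smul_smul]
      rw [this, e]
      module
    rw [e2]
    simp only [Finset.mul_sum, mul_smul_comm, mul_assoc]
  -- From `‖u - v‖² ≤ 2‖u‖² + 2‖v‖²`; after summation both halves contribute equally.
  have hV : ∑ x, ∑ y, ∑ z, ‖F x y z‖ ^ 2 ≤ 4 * ∑ x, ∑ y, ∑ z, ‖f x y z‖ ^ 2 := by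
    rw [Finset.mul_sum]
    refine Finset.sum_le_sum fun x _ => ?_
    have h1 : ∀ y z, ‖F x y z‖ ^ 2 ≤ 2 * ‖f x y z‖ ^ 2 + 2 * ‖f x z y‖ ^ 2 := fun y z => by
      have := pow_le_pow_left₀ (norm_nonneg _) (norm_sub_le (f x y z) (f x z y)) 2
      change ‖f x y z - f x z y‖ ^ 2 ≤ _
      nlinarith [sq_nonneg (‖f x y z‖ - ‖f x z y‖)]
    refine (Finset.sum_le_sum fun y _ => Finset.sum_le_sum fun z _ => h1 y z).trans ?_
    simp only [Finset.sum_add_distrib, ← Finset.mul_sum]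
    rw [Finset.sum_comm (f := fun y z => ‖f x z y‖ ^ 2)]
    linarith
  rw [hT]
  refine (norm_star_tripleOp_sq_le ha hh hah hah' (fun x y z => by simp [hF]) φ).trans ?_
  have hM0 : 0 ≤ M := le_trans (by positivity) hM
  -- The particle and hole terms give `1 + 1/4 = 5/4` times `M`. With the `4` from
  -- antisymmetrization this yields the constant `5`.
  have hb : 1 / 4 * ∑ y, ‖h y φ‖ ^ 2 + ∑ x, ‖a x φ‖ ^ 2 + 1 / 2 * ‖φ‖ ^ 2 ≤
      5 / 4 * (M + ‖φ‖ ^ 2) := by nlinarith [sq_nonneg ‖φ‖]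
  refine (mul_le_mul hV hb (by positivity) (by positivity)).trans (le_of_eq ?_)
  ring

/-- For each `p` the cubic factor is moved onto `Φ`, and one Cauchy–Schwarz in `p` couples it to `a
p Ψ`. This puts the `+ 1` only on the `Φ` side. -/
theorem norm_inner_quartic_le {a : X → H →L[ℂ] H} {h : Y → H →L[ℂ] H}
    (ha : IsCAR a) (hh : IsCAR h) (hah : ∀ x y, a x * h y + h y * a x = 0)
    (hah' : ∀ x y, a x * star (h y) + star (h y) * a x = 0)
    (G : X → X → Y → Y → ℂ) (Φ Ψ : H) {M : ℝ} (hM : ∑ x, ‖a x Φ‖ ^ 2 ≤ M)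
    (hM' : ∑ y, ‖h y Φ‖ ^ 2 ≤ M) :
    ‖inner ℂ Φ ((∑ p, ∑ x, ∑ y, ∑ z, G p x y z • (a x * h y * h z * a p)) Ψ)‖ ≤
      √5 * √(∑ p, ∑ x, ∑ y, ∑ z, ‖G p x y z‖ ^ 2) *
        (√(M + ‖Φ‖ ^ 2) * √(∑ p, ‖a p Ψ‖ ^ 2)) := by
  set T : X → H →L[ℂ] H := fun p => ∑ x, ∑ y, ∑ z, G p x y z • (a x * h y * h z) with hT
  set V : X → ℝ := fun p => ∑ x, ∑ y, ∑ z, ‖G p x y z‖ ^ 2 with hV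
  have hM0 : 0 ≤ M := le_trans (by positivity) hM
  have h1 : ∀ p, ‖star (T p) Φ‖ ^ 2 ≤ 5 * V p * (M + ‖Φ‖ ^ 2) := fun p =>
    norm_star_triple_sq_le ha hh hah hah' (G p) Φ hM hM'
  have h2 : inner ℂ Φ ((∑ p, ∑ x, ∑ y, ∑ z, G p x y z • (a x * h y * h z * a p)) Ψ) =
      ∑ p, inner ℂ (star (T p) Φ) (a p Ψ) := by
    have : ∑ p, ∑ x, ∑ y, ∑ z, G p x y z • (a x * h y * h z * a p) = ∑ p, T p * a p := by
      simp only [hT, Finset.sum_mul, smul_mul_assoc]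
    rw [this, sum_apply, inner_sum]
    exact Finset.sum_congr rfl fun p _ =>
      (ContinuousLinearMap.adjoint_inner_left (T p) (a p Ψ) Φ).symm
  have h3 : ‖∑ p, inner ℂ (star (T p) Φ) (a p Ψ)‖ ^ 2 ≤
      (∑ p, ‖star (T p) Φ‖ ^ 2) * ∑ p, ‖a p Ψ‖ ^ 2 :=
    (pow_le_pow_left₀ (norm_nonneg _) ((norm_sum_le _ _).trans
      (Finset.sum_le_sum fun p _ => norm_inner_le_norm _ _)) 2).trans
        (Finset.sum_mul_sq_le_sq_mul_sq _ _ _)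
  rw [h2]
  refine le_of_sq_le_sq (h3.trans ?_) (by positivity)
  rw [mul_pow, mul_pow, mul_pow, Real.sq_sqrt (by positivity), Real.sq_sqrt (by positivity),
    Real.sq_sqrt (by positivity), Real.sq_sqrt (by positivity), ← mul_assoc]
  refine mul_le_mul_of_nonneg_right ?_ (by positivity)
  rw [Finset.mul_sum, Finset.sum_mul]
  exact Finset.sum_le_sum fun p _ => h1 p

end Bounds
-- Quartic sums over an arbitrary injective family of monomials.
section Indexed

theorem IsCAR.comp {A X Z : Type*} [Ring A] [StarRing A] [DecidableEq X] [DecidableEq Z]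
    {c : X → A} (hc : IsCAR c) {f : Z → X} (hf : Function.Injective f) : IsCAR (c ∘ f) where
  anticomm i j := hc.anticomm _ _
  anticomm_star i j := (hc.anticomm_star _ _).trans (by simp only [hf.eq_iff])

variable {H X Y I : Type*} [NormedAddCommGroup H] [InnerProductSpace ℂ H] [CompleteSpace H]
  [Fintype Y] [Fintype I] [DecidableEq X] [DecidableEq Y]

theorem norm_inner_sum_quartic_le {a : X → H →L[ℂ] H} {h : Y → H →L[ℂ] H}
    (ha : IsCAR a) (hh : IsCAR h) (hah : ∀ x y, a x * h y + h y * a x = 0)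
    (hah' : ∀ x y, a x * star (h y) + star (h y) * a x = 0)
    (p x : I → X) (y z : I → Y) (hinj : Function.Injective fun i => (p i, x i, y i, z i))
    (κ : I → ℂ) (Φ Ψ : H) {M M' : ℝ} (hM : ∀ F : Finset X, ∑ x ∈ F, ‖a x Φ‖ ^ 2 ≤ M)
    (hMh : ∑ y, ‖h y Φ‖ ^ 2 ≤ M) (hM' : ∀ F : Finset X, ∑ x ∈ F, ‖a x Ψ‖ ^ 2 ≤ M') :
    ‖inner ℂ Φ ((∑ i, κ i • (a (x i) * h (y i) * h (z i) * a (p i))) Ψ)‖ ≤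
      √5 * √(∑ i, ‖κ i‖ ^ 2) * (√(M + ‖Φ‖ ^ 2) * √M') := by
  -- There may be infinitely many outer modes, but only finitely many occur. On `W` the coefficients
  -- are extended by zero to all quadruples; injectivity of the indexing keeps their square sum
  -- unchanged.
  set W : Finset X := Finset.univ.image p ∪ Finset.univ.image x with hW
  have hp : ∀ i, p i ∈ W := fun i =>
    Finset.mem_union_left _ (Finset.mem_image_of_mem _ (Finset.mem_univ i))
  have hx : ∀ i, x i ∈ W := fun i =>
    Finset.mem_union_right _ (Finset.mem_image_of_mem _ (Finset.mem_univ i))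
  set a' : W → H →L[ℂ] H := fun w => a w with ha'
  have hca : IsCAR a' := ha.comp Subtype.val_injective
  set g : I → W × W × Y × Y := fun i => (⟨p i, hp i⟩, ⟨x i, hx i⟩, y i, z i) with hg
  have hgi : Function.Injective g := fun i j hij => by
    simp only [hg, Prod.mk.injEq, Subtype.mk.injEq] at hij
    exact hinj (by simp only [Prod.mk.injEq]; exact hij)
  set G : W × W × Y × Y → ℂ := Function.extend g κ 0 with hG
  have hG1 : ∀ i, G (g i) = κ i := fun i => hgi.extend_apply _ _ i
  have hG0 : ∀ j, j ∉ Set.range g → G j = 0 := fun j hj =>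
    Function.extend_apply' _ _ _ fun ⟨i, hi⟩ => hj ⟨i, hi⟩
  have e1 : ∑ i, κ i • (a (x i) * h (y i) * h (z i) * a (p i)) =
      ∑ p, ∑ x, ∑ y, ∑ z, G (p, x, y, z) • (a' x * h y * h z * a' p) := by
    simp only [← Fintype.sum_prod_type']
    exact Fintype.sum_of_injective g hgi _ _ (fun j hj => by rw [hG0 j hj, zero_smul])
      fun i => by rw [hG1]
  have e2 : ∑ i, ‖κ i‖ ^ 2 = ∑ p, ∑ x, ∑ y, ∑ z, ‖G (p, x, y, z)‖ ^ 2 := by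
    simp only [← Fintype.sum_prod_type']
    exact Fintype.sum_of_injective g hgi _ _ (fun j hj => by rw [hG0 j hj]; simp)
      fun i => by rw [hG1]
  have e3 : ∀ φ, ∑ w, ‖a' w φ‖ ^ 2 = ∑ x ∈ W, ‖a x φ‖ ^ 2 := fun φ =>
    Finset.sum_coe_sort W fun x => ‖a x φ‖ ^ 2
  rw [e1, e2]
  refine (norm_inner_quartic_le hca hh (fun x y => hah x y) (fun x y => hah' x y)
    (fun p x y z => G (p, x, y, z)) Φ Ψ (M := M) ((e3 Φ).trans_le (hM W)) hMh).trans ?_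
  gcongr
  exact (e3 Ψ).trans_le (hM' W)

end Indexed

/-! ### Particles and holes relative to a finite set of modes. -/

noncomputable section Modes

set_option linter.unusedSectionVars false

variable {E ι : Type*} [NormedAddCommGroup E] [InnerProductSpace ℂ E] [DecidableEq ι]

theorem isCAR_fockAnnihilate {u : ι → E} (hu : Orthonormal ℂ u) :
    IsCAR fun i => fockAnnihilate (u i) where
  anticomm i j := fockAnnihilate_mul_fockAnnihilate _ _
  anticomm_star i j := by
    rw [star_fockAnnihilate, fockAnnihilate_mul_fockCreate, orthonormal_iff_ite.mp hu]
    split_ifs <;> simp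

/-- Particle-hole symmetry: the relations are invariant under exchanging an operator with its
adjoint, so creation operators can serve as annihilators of holes. -/
theorem isCAR_fockCreate {u : ι → E} (hu : Orthonormal ℂ u) :
    IsCAR fun i => fockCreate (u i) where
  anticomm i j := fockCreate_mul_fockCreate _ _
  anticomm_star i j := by
    rw [star_fockCreate, add_comm, fockAnnihilate_mul_fockCreate, orthonormal_iff_ite.mp hu]
    simp only [eq_comm (a := j)]
    split_ifs <;> simp

theorem inner_createAnnihilate_right (n : ℕ) (u v : E) (x y : FermionSpace E n) :
    inner ℂ x (createAnnihilate u v n y) =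
      inner ℂ (fockAnnihilate u (sector n x)) (fockAnnihilate v (sector n y)) := by
  rw [← (sector n).inner_map_map, ← fockCreate_fockAnnihilate_sector, fockCreate,
    ContinuousLinearMap.adjoint_inner_right]

theorem inner_createAnnihilate_left (n : ℕ) (u v : E) (x y : FermionSpace E n) :
    inner ℂ (createAnnihilate u v n x) y = inner ℂ x (createAnnihilate v u n y) := by
  rw [← inner_conj_symm, inner_createAnnihilate_right, inner_conj_symm,
    inner_createAnnihilate_right]

theorem re_inner_createAnnihilate_self (n : ℕ) (u : E) (x : FermionSpace E n) :
    (inner ℂ x (createAnnihilate u u n x)).re = ‖fockAnnihilate u (sector n x)‖ ^ 2 := by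
  rw [inner_createAnnihilate_right]
  exact inner_self_eq_norm_sq (𝕜 := ℂ) _

theorem inner_sum_createAnnihilate (n : ℕ) {I : Type*} [Fintype I] (κ : I → ℂ)
    (t u v w : I → E) (x y : FermionSpace E n) :
    inner ℂ x (∑ i, κ i • createAnnihilate (t i) (u i) n (createAnnihilate (v i) (w i) n y)) =
      inner ℂ (sector n x) ((∑ i, κ i • (fockCreate (t i) * fockAnnihilate (u i) *
        (fockCreate (v i) * fockAnnihilate (w i)))) (sector n y)) := by
  rw [sum_apply, inner_sum, inner_sum]
  refine Finset.sum_congr rfl fun i _ => ?_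
  rw [smul_apply, inner_smul_right, inner_smul_right, ← (sector n).inner_map_map,
    ← fockCreate_fockAnnihilate_sector, ← fockCreate_fockAnnihilate_sector]
  rfl

/-- The order is chosen so that one particle annihilator stands rightmost and acts on `Ψ`, leaving a
cubic factor `a h h` to be moved onto `Φ`. The overall sign is irrelevant for the estimate. -/
theorem pair_mul_pair {A : Type*} [Ring A] {a a' h h' : A} (hh : h * h' + h' * h = 0)
    (haa : a * a' + a' * a = 0) (h1 : a * h' + h' * a = 0) (h2 : a' * h + h * a' = 0)
    (h3 : a' * h' + h' * a' = 0) : h * a * (h' * a') = -(a' * h' * h * a) := by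
  have e1 := eq_neg_of_add_eq_zero_left h1
  have e2 := eq_neg_of_add_eq_zero_left haa
  have e3 := eq_neg_of_add_eq_zero_left hh
  have e4 := eq_neg_of_add_eq_zero_right h2
  have e5 := eq_neg_of_add_eq_zero_right h3
  calc h * a * (h' * a') = h * (a * h') * a' := by simp only [mul_assoc]
    _ = -(h * h' * (a * a')) := by rw [e1]; simp only [mul_assoc, mul_neg, neg_mul]
    _ = -(h' * (h * a') * a) := by
      rw [e2, e3]; simp only [mul_assoc, mul_neg, neg_mul, neg_neg]
    _ = h' * a' * h * a := by rw [e4]; simp only [mul_assoc, mul_neg, neg_mul, neg_neg]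
    _ = -(a' * h' * h * a) := by rw [e5, neg_mul, neg_mul]

variable [CompleteSpace E] (b : HilbertBasis ι ℂ E) (n : ℕ) (B : Finset ι)

/-- The number of particles outside of the modes in `B`. -/
def outsideNumber (x : FermionSpace E n) : FermionSpace E n :=
  ∑' a : {a // a ∉ B}, createAnnihilate (b a) (b a) n x

theorem summable_createAnnihilate_subtype (p : ι → Prop) (x : FermionSpace E n) :
    Summable fun a : {a // p a} => createAnnihilate (b a) (b a) n x :=
  (hasSum_createAnnihilate b n x).summable.comp_injective Subtype.val_injective

theorem hasSum_norm_sq_fockAnnihilate (x : FermionSpace E n) :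
    HasSum (fun a => ‖fockAnnihilate (b a) (sector n x)‖ ^ 2) (n * ‖x‖ ^ 2) := by
  have h := Complex.hasSum_re ((innerSL ℂ x).hasSum (hasSum_createAnnihilate b n x))
  simp only [innerSL_apply_apply, re_inner_createAnnihilate_self] at h
  convert h using 1
  rw [← Nat.cast_smul_eq_nsmul ℂ, inner_smul_right, ← Complex.ofReal_natCast,
    Complex.re_ofReal_mul]
  congr 1
  exact (inner_self_eq_norm_sq (𝕜 := ℂ) x).symm

theorem hasSum_norm_sq_fockAnnihilate_outside (x : FermionSpace E n) :
    HasSum (fun a : {a // a ∉ B} => ‖fockAnnihilate (b a) (sector n x)‖ ^ 2)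
      (inner ℂ x (outsideNumber b n B x)).re := by
  have h := Complex.hasSum_re
    ((innerSL ℂ x).hasSum (summable_createAnnihilate_subtype b n (· ∉ B) x).hasSum)
  simp only [innerSL_apply_apply, re_inner_createAnnihilate_self] at h
  exact h

theorem re_inner_outsideNumber_nonneg (x : FermionSpace E n) :
    0 ≤ (inner ℂ x (outsideNumber b n B x)).re :=
  (hasSum_norm_sq_fockAnnihilate_outside b n B x).nonneg fun _ => sq_nonneg _

theorem re_inner_outsideNumber_le (x : FermionSpace E n) :
    (inner ℂ x (outsideNumber b n B x)).re ≤ n * ‖x‖ ^ 2 := by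
  rw [← (hasSum_norm_sq_fockAnnihilate_outside b n B x).tsum_eq,
    ← (hasSum_norm_sq_fockAnnihilate b n x).tsum_eq]
  exact Summable.tsum_subtype_le (fun a => ‖fockAnnihilate (b a) (sector n x)‖ ^ 2) {a | a ∉ B}
    (fun _ => sq_nonneg _) (hasSum_norm_sq_fockAnnihilate b n x).summable

theorem norm_sq_fockCreate (a : ι) (x : FermionSpace E n) :
    ‖fockCreate (b a) (sector n x)‖ ^ 2 =
      ‖x‖ ^ 2 - ‖fockAnnihilate (b a) (sector n x)‖ ^ 2 := by
  have h := congrArg (reForm (sector n x)) ((isCAR_fockCreate b.orthonormal).anticomm_star a a)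
  rw [if_pos rfl, map_add, reForm_mul_star_self, reForm_star_mul_self, reForm_one,
    (sector n).norm_map, star_fockCreate] at h
  rw [← h]
  ring

/-- If `B` has `n` elements, there are as many holes in `B` as particles outside of `B`. -/
theorem sum_norm_sq_fockCreate (hB : B.card = n) (x : FermionSpace E n) :
    ∑ y : B, ‖fockCreate (b y) (sector n x)‖ ^ 2 = (inner ℂ x (outsideNumber b n B x)).re := by
  -- The total `n * ‖x‖ ^ 2` splits into modes inside and outside `B`. Each mode inside contributes
  -- `‖x‖ ^ 2` minus its occupation to the hole count, so `B.card = n` is exactly what makes the two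
  -- counts agree.
  have h := (hasSum_norm_sq_fockAnnihilate b n x).summable.sum_add_tsum_subtype_compl B
  rw [(hasSum_norm_sq_fockAnnihilate b n x).tsum_eq,
    (hasSum_norm_sq_fockAnnihilate_outside b n B x).tsum_eq] at h
  rw [Finset.sum_coe_sort B fun y => ‖fockCreate (b y) (sector n x)‖ ^ 2]
  simp only [norm_sq_fockCreate, Finset.sum_sub_distrib]
  rw [sub_eq_iff_eq_add', h, Finset.sum_const, hB, nsmul_eq_mul]

/-- A sum of products of four quasi-particle annihilation operators on the `n`-particle space is
bounded by `√5 ‖κ‖ (𝒩 + 1)^{1/2} 𝒩^{1/2}`. -/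
theorem norm_inner_sum_hop_le (hB : B.card = n) {I : Type*} [Fintype I]
    (p x : I → {a // a ∉ B}) (y z : I → B) (hinj : Function.Injective fun i => (p i, x i, y i, z i))
    (κ : I → ℂ) (Φ Ψ : FermionSpace E n) :
    ‖inner ℂ Φ (∑ i, κ i • createAnnihilate (b (z i)) (b (p i)) n
        (createAnnihilate (b (y i)) (b (x i)) n Ψ))‖ ≤
      √5 * √(∑ i, ‖κ i‖ ^ 2) * (√((inner ℂ Φ (outsideNumber b n B Φ)).re + ‖Φ‖ ^ 2) *
        √((inner ℂ Ψ (outsideNumber b n B Ψ)).re)) := by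
  set a : {a // a ∉ B} → FockSpace E →L[ℂ] FockSpace E := fun x => fockAnnihilate (b x) with ha
  set h : B → FockSpace E →L[ℂ] FockSpace E := fun y => fockCreate (b y) with hh
  have hca : IsCAR a := (isCAR_fockAnnihilate b.orthonormal).comp Subtype.val_injective
  have hch : IsCAR h := (isCAR_fockCreate b.orthonormal).comp Subtype.val_injective
  -- Particle modes lie outside `B` and hole modes inside, so the inner product in the mixed
  -- relation vanishes.
  have hah : ∀ x y, a x * h y + h y * a x = 0 := fun x y => by
    have hne : (x : ι) ≠ y := fun e => x.2 (e ▸ y.2)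
    simp only [ha, hh]
    rw [fockAnnihilate_mul_fockCreate, b.orthonormal.inner_eq_zero hne, zero_smul]
  have hah' : ∀ x y, a x * star (h y) + star (h y) * a x = 0 := fun x y => by
    simp only [ha, hh]
    rw [star_fockCreate, fockAnnihilate_mul_fockAnnihilate]
  have hop : ∀ i, h (z i) * a (p i) * (h (y i) * a (x i)) =
      -(a (x i) * h (y i) * h (z i) * a (p i)) := fun i =>
    pair_mul_pair (hch.anticomm _ _) (hca.anticomm _ _) (hah _ _) (hah _ _) (hah _ _)
  have hsec : inner ℂ Φ (∑ i, κ i • createAnnihilate (b (z i)) (b (p i)) n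
      (createAnnihilate (b (y i)) (b (x i)) n Ψ)) = inner ℂ (sector n Φ)
        ((∑ i, (-κ i) • (a (x i) * h (y i) * h (z i) * a (p i))) (sector n Ψ)) := by
    simp only [neg_smul, ← smul_neg, ← hop]
    exact inner_sum_createAnnihilate n κ (fun i => b (z i)) (fun i => b (p i))
      (fun i => b (y i)) (fun i => b (x i)) Φ Ψ
  rw [hsec]
  refine (norm_inner_sum_quartic_le hca hch hah hah' p x y z hinj (fun i => -κ i) (sector n Φ)
    (sector n Ψ)
    (fun F => sum_le_hasSum F (fun _ _ => sq_nonneg _)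
      (hasSum_norm_sq_fockAnnihilate_outside b n B Φ))
    (sum_norm_sq_fockCreate b n B hB Φ).le
    (fun F => sum_le_hasSum F (fun _ _ => sq_nonneg _)
      (hasSum_norm_sq_fockAnnihilate_outside b n B Ψ))).trans (le_of_eq ?_)
  simp only [norm_neg, (sector n).norm_map]

end Modes
-- Plane waves, the Fermi ball and the excitation number.
noncomputable section Specialization

variable (s : ℕ) (kF : ℝ)

theorem planeWaveBasis_apply (a : (Fin 3 → ℤ) × Fin s) : planeWaveBasis s a = planeWave a := by
  rw [planeWaveBasis, HilbertBasis.coe_mk]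

theorem createAnnihilate_planeWaveBasis (a b : (Fin 3 → ℤ) × Fin s) :
    createAnnihilate (planeWaveBasis s a) (planeWaveBasis s b) (particleNumber s kF) =
      hop s kF a b := by
  rw [planeWaveBasis_apply, planeWaveBasis_apply, hop]

/-- The states in the Fermi ball. -/
def fermiStates : Finset ((Fin 3 → ℤ) × Fin s) := fermiBall kF ×ˢ Finset.univ

theorem mem_fermiStates {a : (Fin 3 → ℤ) × Fin s} : a ∈ fermiStates s kF ↔ a.1 ∈ fermiBall kF := by
  simp [fermiStates]

theorem card_fermiStates : (fermiStates s kF).card = particleNumber s kF := by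
  simp [fermiStates, particleNumber, mul_comm]

theorem outsideNumber_fermiStates (Ψ : ManyBody s kF) :
    outsideNumber (planeWaveBasis s) (particleNumber s kF) (fermiStates s kF) Ψ =
      excitationNumber s kF Ψ := by
  unfold outsideNumber excitationNumber
  simp only [createAnnihilate_planeWaveBasis]
  exact (Equiv.subtypeEquivRight fun a => by rw [mem_fermiStates]).tsum_eq
    (fun a : OuterState s kF => hop s kF a.1 a.1 Ψ)

theorem summable_hop_outer (Ψ : ManyBody s kF) :
    Summable fun a : OuterState s kF => hop s kF a.1 a.1 Ψ := by
  have h := summable_createAnnihilate_subtype (planeWaveBasis s) (particleNumber s kF)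
    (fun a => a.1 ∉ fermiBall kF) Ψ
  simp only [createAnnihilate_planeWaveBasis] at h
  exact h

/-- The quadratic form `⟨Ψ, (𝒩_E + 1) Ψ⟩`. -/
def excitationForm (Ψ : ManyBody s kF) : ℝ := (inner ℂ Ψ (excitationNumber s kF Ψ + Ψ)).re

theorem excitationForm_eq (Ψ : ManyBody s kF) :
    excitationForm s kF Ψ = (inner ℂ Ψ (outsideNumber (planeWaveBasis s) (particleNumber s kF)
      (fermiStates s kF) Ψ)).re + ‖Ψ‖ ^ 2 := by
  rw [excitationForm, inner_add_right, Complex.add_re, outsideNumber_fermiStates]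
  congr 1
  exact inner_self_eq_norm_sq (𝕜 := ℂ) Ψ

theorem excitationForm_nonneg (Ψ : ManyBody s kF) : 0 ≤ excitationForm s kF Ψ := by
  rw [excitationForm_eq]
  exact add_nonneg (re_inner_outsideNumber_nonneg _ _ _ Ψ) (sq_nonneg _)

/-- Boundedness comes from the outer number being at most `N` on the sector; this is what later
turns form bounds into operator norm bounds. -/
theorem excitationForm_le (Ψ : ManyBody s kF) :
    excitationForm s kF Ψ ≤ (particleNumber s kF + 1) * ‖Ψ‖ ^ 2 := by
  rw [excitationForm_eq, add_mul, one_mul]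
  exact add_le_add (re_inner_outsideNumber_le _ _ _ Ψ) le_rfl

theorem inner_hop_left (a b : (Fin 3 → ℤ) × Fin s) (Φ Ψ : ManyBody s kF) :
    inner ℂ (hop s kF a b Φ) Ψ = inner ℂ Φ (hop s kF b a Ψ) :=
  inner_createAnnihilate_left _ _ _ Φ Ψ

theorem norm_inner_sum_hop_hop_le {I : Type*} [Fintype I] (p x y z : I → (Fin 3 → ℤ) × Fin s)
    (hp : ∀ i, (p i).1 ∉ fermiBall kF) (hx : ∀ i, (x i).1 ∉ fermiBall kF)
    (hy : ∀ i, (y i).1 ∈ fermiBall kF) (hz : ∀ i, (z i).1 ∈ fermiBall kF)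
    (hinj : Function.Injective fun i => (p i, x i, y i, z i)) (κ : I → ℂ) (Φ Ψ : ManyBody s kF) :
    ‖inner ℂ Φ (∑ i, κ i • hop s kF (z i) (p i) (hop s kF (y i) (x i) Ψ))‖ ≤
      √5 * √(∑ i, ‖κ i‖ ^ 2) * (√(excitationForm s kF Φ) * √(excitationForm s kF Ψ)) := by
  have h := norm_inner_sum_hop_le (planeWaveBasis s) (particleNumber s kF) (fermiStates s kF)
    (card_fermiStates s kF)
    (fun i => ⟨p i, (mem_fermiStates s kF).not.mpr (hp i)⟩)
    (fun i => ⟨x i, (mem_fermiStates s kF).not.mpr (hx i)⟩)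
    (fun i => ⟨y i, (mem_fermiStates s kF).mpr (hy i)⟩)
    (fun i => ⟨z i, (mem_fermiStates s kF).mpr (hz i)⟩)
    (fun i j hij => by
      simp only [Prod.mk.injEq, Subtype.mk.injEq] at hij
      exact hinj (by simp only [Prod.mk.injEq]; exact hij)) κ Φ Ψ
  simp only [createAnnihilate_planeWaveBasis] at h
  refine h.trans ?_
  rw [← excitationForm_eq]
  gcongr
  rw [excitationForm_eq]
  exact le_add_of_nonneg_right (sq_nonneg _)

end Specialization
-- Lunes, Hilbert–Schmidt norms and the indexing of monomials.
noncomputable section Lunes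

variable (s : ℕ) (kF : ℝ)

theorem mem_fermiBall {p : Fin 3 → ℤ} : p ∈ fermiBall kF ↔ momentumNorm p ≤ kF := by
  simp [fermiBall]

theorem neg_mem_fermiBall {p : Fin 3 → ℤ} : -p ∈ fermiBall kF ↔ p ∈ fermiBall kF := by
  have h : momentumNorm (-p) = momentumNorm p := by
    rw [momentumNorm, momentumNorm, ← norm_neg]
    congr 1
    ext i
    simp
  rw [mem_fermiBall, mem_fermiBall, h]

theorem mem_lune {l p : Fin 3 → ℤ} :
    p ∈ lune kF l ↔ p - l ∈ fermiBall kF ∧ p ∉ fermiBall kF := by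
  rw [lune, Finset.mem_sdiff, Finset.mem_image]
  refine and_congr_left' ⟨?_, fun h => ⟨p - l, h, sub_add_cancel p l⟩⟩
  rintro ⟨q, hq, rfl⟩
  rwa [add_sub_cancel_right]

theorem hsNormSq_eq_sum {l : Fin 3 → ℤ} (T : LuneSpace kF l →ₗ[ℝ] LuneSpace kF l) :
    hsNormSq T = ∑ p, ∑ q, (inner ℝ (luneVec p) (T (luneVec q)) : ℝ) ^ 2 := by
  rw [hsNormSq, Finset.sum_comm]
  refine Finset.sum_congr rfl fun q _ => ?_
  rw [EuclideanSpace.norm_sq_eq]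
  refine Finset.sum_congr rfl fun p _ => ?_
  rw [EuclideanSpace.inner_single_left]
  simp

theorem hsNormSq_nonneg {l : Fin 3 → ℤ} (T : LuneSpace kF l →ₗ[ℝ] LuneSpace kF l) :
    0 ≤ hsNormSq T :=
  Finset.sum_nonneg fun _ _ => sq_nonneg _

/-- The indices of the monomials in `∑_{l ∈ S} ∑_{p,q ∈ L_l} ⟨e_p, K_l e_q⟩ b_{l,p} b_{-l,-q}`. -/
abbrev MonomialIndex (S : Finset NonzeroMomentum) : Type :=
  Σ l : S, (lune kF l.1 × lune kF l.1) × (Fin s × Fin s)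

/-- The entries `p` and `p - l` recover `l`, and `-q` recovers `q`. Thus distinct `l` contribute
distinct monomials, and their Hilbert–Schmidt norms combine in square. -/
theorem monomialIndex_injective (S : Finset NonzeroMomentum) : Function.Injective
    fun i : MonomialIndex s kF S => (((i.2.1.1.1, i.2.2.1) : (Fin 3 → ℤ) × Fin s),
      ((-i.2.1.2.1, i.2.2.2) : (Fin 3 → ℤ) × Fin s),
      ((-i.2.1.2.1 - -i.1.1.1, i.2.2.2) : (Fin 3 → ℤ) × Fin s),
      ((i.2.1.1.1 - i.1.1.1, i.2.2.1) : (Fin 3 → ℤ) × Fin s)) := by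
  rintro ⟨⟨⟨l, hl⟩, hlS⟩, ⟨⟨p, hp⟩, ⟨q, hq⟩⟩, σ, τ⟩
    ⟨⟨⟨l', hl'⟩, hlS'⟩, ⟨⟨p', hp'⟩, ⟨q', hq'⟩⟩, σ', τ'⟩ h
  simp only [Prod.mk.injEq] at h
  obtain ⟨⟨rfl, rfl⟩, ⟨hqq, rfl⟩, -, hll, -⟩ := h
  obtain rfl := neg_injective hqq
  obtain rfl := sub_right_injective hll
  rfl

/-- The coefficients of the monomials. -/
def monomialCoeff (K : (l : NonzeroMomentum) → LuneSpace kF l →ₗ[ℝ] LuneSpace kF l)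
    (S : Finset NonzeroMomentum) (i : MonomialIndex s kF S) : ℂ :=
  (s : ℂ)⁻¹ * ((inner ℝ (luneVec i.2.1.1) (K i.1 (luneVec i.2.1.2)) : ℝ) : ℂ)

/-- The `s ^ 2` spin pairs compensate the square of the normalization `1 / s`, so the bound has no
dependence on `s`. -/
theorem sum_norm_sq_monomialCoeff (hs : 0 < s)
    (K : (l : NonzeroMomentum) → LuneSpace kF l →ₗ[ℝ] LuneSpace kF l)
    (S : Finset NonzeroMomentum) :
    ∑ i, ‖monomialCoeff s kF K S i‖ ^ 2 = ∑ l ∈ S, hsNormSq (K l) := by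
  rw [← Finset.sum_coe_sort S, Fintype.sum_sigma]
  refine Finset.sum_congr rfl fun l _ => ?_
  rw [hsNormSq_eq_sum]
  simp only [monomialCoeff, Fintype.sum_prod_type, norm_mul, mul_pow, norm_inv,
    Complex.norm_natCast, Complex.norm_real, Real.norm_eq_abs, sq_abs]
  refine Finset.sum_congr rfl fun p _ => Finset.sum_congr rfl fun q _ => ?_
  change ∑ _σ : Fin s, ∑ _τ : Fin s, (s : ℝ)⁻¹ ^ 2 *
    (inner ℝ (luneVec p) (K l (luneVec q)) : ℝ) ^ 2 = _
  rw [Finset.sum_const, Finset.sum_const, Finset.card_univ, Fintype.card_fin, nsmul_eq_mul,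
    nsmul_eq_mul]
  have : (s : ℝ) ≠ 0 := by positivity
  field_simp

end Lunes

/-! ### The kernel for abstract hopping operators: form bound, summability and limit. -/

noncomputable section AbstractKernel

variable {H : Type*} [NormedAddCommGroup H] [InnerProductSpace ℂ H] {s : ℕ} {kF : ℝ}

/-- Operators `w a b`, with adjoints `w b a`, whose quartic excitation monomials are bounded by the
quadratic form `Q` in the way in which `c_a* c_b` are bounded by `𝒩_E + 1`. -/
structure IsHopping (kF : ℝ)
    (w : (Fin 3 → ℤ) × Fin s → (Fin 3 → ℤ) × Fin s → H →L[ℂ] H) (Q : H → ℝ) (C : ℝ) : Prop where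
  inner_left : ∀ a b Φ Ψ, inner ℂ (w a b Φ) Ψ = inner ℂ Φ (w b a Ψ)
  pos : 0 < C
  nonneg : ∀ Φ, 0 ≤ Q Φ
  le : ∀ Φ, Q Φ ≤ C * ‖Φ‖ ^ 2
  norm_inner_sum_le : ∀ {I : Type} [Fintype I] (p x y z : I → (Fin 3 → ℤ) × Fin s),
    (∀ i, (p i).1 ∉ fermiBall kF) → (∀ i, (x i).1 ∉ fermiBall kF) →
    (∀ i, (y i).1 ∈ fermiBall kF) → (∀ i, (z i).1 ∈ fermiBall kF) →
    (Function.Injective fun i => (p i, x i, y i, z i)) → ∀ (κ : I → ℂ) (Φ Ψ : H),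
    ‖inner ℂ Φ (∑ i, κ i • w (z i) (p i) (w (y i) (x i) Ψ))‖ ≤
      √5 * √(∑ i, ‖κ i‖ ^ 2) * (√(Q Φ) * √(Q Ψ))

variable (w : (Fin 3 → ℤ) × Fin s → (Fin 3 → ℤ) × Fin s → H →L[ℂ] H)

/-- The operator `b_{k,p}` built from the hopping operators `w`. -/
def exciteOf (k p : Fin 3 → ℤ) : H →L[ℂ] H :=
  ((1 / √(s : ℝ) : ℝ) : ℂ) • ∑ σ, w (p - k, σ) (p, σ)

/-- The operator `b*_{k,p}` built from the hopping operators `w`. -/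
def exciteStarOf (k p : Fin 3 → ℤ) : H →L[ℂ] H :=
  ((1 / √(s : ℝ) : ℝ) : ℂ) • ∑ σ, w (p, σ) (p - k, σ)

/-- The contribution of `l` to the kernel built from the hopping operators `w`. -/
def kernelOf (l : Fin 3 → ℤ) (T : LuneSpace kF l →ₗ[ℝ] LuneSpace kF l) : H →L[ℂ] H :=
  (1 / 2 : ℂ) • ∑ p : lune kF l, ∑ q : lune kF l,
    ((inner ℝ (luneVec p) (T (luneVec q)) : ℝ) : ℂ) •
      (exciteOf w l p ∘L exciteOf w (-l) (-q) - exciteStarOf w (-l) (-q) ∘L exciteStarOf w l p)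

/-- The sesquilinear form of `∑_{p,q ∈ L_l} ⟨e_p, T e_q⟩ b_{l,p} b_{-l,-q}`. -/
def pairForm (l : Fin 3 → ℤ) (T : LuneSpace kF l →ₗ[ℝ] LuneSpace kF l) (Φ Ψ : H) : ℂ :=
  ∑ p : lune kF l, ∑ q : lune kF l, ((inner ℝ (luneVec p) (T (luneVec q)) : ℝ) : ℂ) *
    inner ℂ Φ (exciteOf w l p (exciteOf w (-l) (-q) Ψ))

variable {w} {Q : H → ℝ} {C : ℝ}

theorem inner_exciteOf_right (k p : Fin 3 → ℤ) (Φ Ψ : H) :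
    inner ℂ Φ (exciteOf w k p Ψ) =
      ((1 / √(s : ℝ) : ℝ) : ℂ) * ∑ σ, inner ℂ Φ (w (p - k, σ) (p, σ) Ψ) := by
  rw [exciteOf, smul_apply, sum_apply, inner_smul_right, inner_sum]

theorem IsHopping.inner_exciteStarOf_right (hw : IsHopping kF w Q C) (k p : Fin 3 → ℤ) (Φ Ψ : H) :
    inner ℂ Φ (exciteStarOf w k p Ψ) = inner ℂ (exciteOf w k p Φ) Ψ := by
  rw [exciteStarOf, exciteOf, smul_apply, smul_apply, sum_apply, sum_apply, inner_smul_right,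
    inner_smul_left, inner_sum, sum_inner, Complex.conj_ofReal]
  simp only [hw.inner_left]

theorem IsHopping.inner_exciteOf_exciteOf (hw : IsHopping kF w Q C) (k p k' p' : Fin 3 → ℤ)
    (Φ Ψ : H) :
    inner ℂ Φ (exciteOf w k p (exciteOf w k' p' Ψ)) = (s : ℂ)⁻¹ * ∑ σ, ∑ τ,
      inner ℂ Φ (w (p - k, σ) (p, σ) (w (p' - k', τ) (p', τ) Ψ)) := by
  have hs : ((1 / √(s : ℝ) : ℝ) : ℂ) * ((1 / √(s : ℝ) : ℝ) : ℂ) = (s : ℂ)⁻¹ := by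
    rw [← Complex.ofReal_mul, div_mul_div_comm, Real.mul_self_sqrt (Nat.cast_nonneg s), one_mul,
      one_div, Complex.ofReal_inv, Complex.ofReal_natCast]
  rw [inner_exciteOf_right, ← hs, mul_assoc]
  congr 1
  rw [Finset.mul_sum]
  refine Finset.sum_congr rfl fun σ _ => ?_
  rw [← hw.inner_left, inner_exciteOf_right]
  simp only [hw.inner_left]

/-- The starred products are the adjoints of the unstarred ones and the coefficients are real, so it
suffices to estimate `pairForm`. -/
theorem IsHopping.inner_kernelOf (hw : IsHopping kF w Q C) (l : Fin 3 → ℤ)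
    (T : LuneSpace kF l →ₗ[ℝ] LuneSpace kF l) (Φ Ψ : H) :
    inner ℂ Φ (kernelOf w l T Ψ) = 1 / 2 * (pairForm w l T Φ Ψ -
      (starRingEnd ℂ) (pairForm w l T Ψ Φ)) := by
  have h : ∀ p q : lune kF l, inner ℂ Φ (exciteStarOf w (-l) (-q) (exciteStarOf w l p Ψ)) =
      (starRingEnd ℂ) (inner ℂ Ψ (exciteOf w l p (exciteOf w (-l) (-q) Φ))) := fun p q => by
    rw [hw.inner_exciteStarOf_right, hw.inner_exciteStarOf_right, inner_conj_symm]
  simp only [kernelOf, pairForm, smul_apply, sum_apply, sub_apply, inner_smul_right, inner_sum,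
    inner_sub_right, mul_sub, Finset.sum_sub_distrib, map_sum, map_mul, Complex.conj_ofReal, ← h]
  rfl

/-- All `l` are gathered into one quartic sum before estimating. Bounding each `l` separately would
give the sum of the Hilbert–Schmidt norms instead of the root of the sum of their squares. -/
theorem IsHopping.sum_pairForm (hw : IsHopping kF w Q C)
    (K : (l : NonzeroMomentum) → LuneSpace kF l →ₗ[ℝ] LuneSpace kF l)
    (S : Finset NonzeroMomentum) (Φ Ψ : H) :
    ∑ l ∈ S, pairForm w l (K l) Φ Ψ = inner ℂ Φ (∑ i : MonomialIndex s kF S,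
      monomialCoeff s kF K S i • w (i.2.1.1.1 - i.1.1.1, i.2.2.1) (i.2.1.1.1, i.2.2.1)
        (w (-i.2.1.2.1 - -i.1.1.1, i.2.2.2) (-i.2.1.2.1, i.2.2.2) Ψ)) := by
  have hr : ∀ (r c : ℂ) (f : Fin s → Fin s → ℂ),
      c * (r * ∑ σ, ∑ τ, f σ τ) = ∑ σ, ∑ τ, r * c * f σ τ := fun r c f => by
    simp only [← Finset.mul_sum]
    ring
  simp only [inner_sum, inner_smul_right]
  rw [← Finset.sum_coe_sort S, Fintype.sum_sigma]
  refine Finset.sum_congr rfl fun l _ => ?_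
  rw [pairForm, Fintype.sum_prod_type, Fintype.sum_prod_type]
  refine Finset.sum_congr rfl fun p _ => Finset.sum_congr rfl fun q _ => ?_
  rw [Fintype.sum_prod_type, hw.inner_exciteOf_exciteOf, hr]
  rfl

theorem IsHopping.norm_sum_pairForm_le (hw : IsHopping kF w Q C) (hs : 0 < s)
    (K : (l : NonzeroMomentum) → LuneSpace kF l →ₗ[ℝ] LuneSpace kF l)
    (S : Finset NonzeroMomentum) (Φ Ψ : H) :
    ‖∑ l ∈ S, pairForm w l (K l) Φ Ψ‖ ≤ √5 * √(∑ l ∈ S, hsNormSq (K l)) *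
      (√(Q Φ) * √(Q Ψ)) := by
  rw [hw.sum_pairForm, ← sum_norm_sq_monomialCoeff s kF hs]
  exact hw.norm_inner_sum_le
    (fun i : MonomialIndex s kF S => (i.2.1.1.1, i.2.2.1)) (fun i => (-i.2.1.2.1, i.2.2.2))
    (fun i => (-i.2.1.2.1 - -i.1.1.1, i.2.2.2)) (fun i => (i.2.1.1.1 - i.1.1.1, i.2.2.1))
    (fun i => ((mem_lune kF).mp i.2.1.1.2).2)
    (fun i => (neg_mem_fermiBall kF).not.mpr ((mem_lune kF).mp i.2.1.2.2).2)
    (fun i => by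
      -- The hole momentum `-q + l` equals `-(q - l)`, which lies in the ball by its reflection
      -- symmetry.
      have := (neg_mem_fermiBall kF).mpr ((mem_lune kF).mp i.2.1.2.2).1
      rwa [neg_sub'] at this)
    (fun i => ((mem_lune kF).mp i.2.1.1.2).1)
    (monomialIndex_injective s kF S) _ Φ Ψ

/-- The right side of the `pairForm` bound is symmetric in `Φ` and `Ψ`. The form and its adjoint
thus obey the same bound, and the factor `1/2` averages them without changing the constant. -/
theorem IsHopping.norm_inner_sum_kernelOf_le (hw : IsHopping kF w Q C) (hs : 0 < s)
    (K : (l : NonzeroMomentum) → LuneSpace kF l →ₗ[ℝ] LuneSpace kF l)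
    (S : Finset NonzeroMomentum) (Φ Ψ : H) :
    ‖∑ l ∈ S, inner ℂ Φ (kernelOf w l (K l) Ψ)‖ ≤ √5 * √(∑ l ∈ S, hsNormSq (K l)) *
      (√(Q Φ) * √(Q Ψ)) := by
  have h1 := hw.norm_sum_pairForm_le hs K S Φ Ψ
  have h2 := hw.norm_sum_pairForm_le hs K S Ψ Φ
  simp only [hw.inner_kernelOf]
  rw [← Finset.mul_sum, Finset.sum_sub_distrib, ← map_sum, norm_mul]
  have h3 := norm_sub_le (∑ l ∈ S, pairForm w l (K l) Φ Ψ)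
    ((starRingEnd ℂ) (∑ l ∈ S, pairForm w l (K l) Ψ Φ))
  rw [RCLike.norm_conj] at h3
  rw [mul_comm √(Q Ψ)] at h2
  have h4 : ‖(1 / 2 : ℂ)‖ = 1 / 2 := by norm_num
  rw [h4]
  linarith

/-- Apply the form bound with `Φ` equal to the image vector `v`, replace `Q` by `C * ‖·‖ ^ 2`, and
cancel one factor `‖v‖`. -/
theorem IsHopping.norm_sum_kernelOf_le (hw : IsHopping kF w Q C) (hs : 0 < s)
    (K : (l : NonzeroMomentum) → LuneSpace kF l →ₗ[ℝ] LuneSpace kF l)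
    (S : Finset NonzeroMomentum) :
    ‖∑ l ∈ S, kernelOf w l (K l)‖ ≤
      √5 * √(∑ l ∈ S, hsNormSq (K l)) * C := by
  have hC := hw.pos
  refine ContinuousLinearMap.opNorm_le_bound _ (by positivity) fun Ψ => ?_
  set v := (∑ l ∈ S, kernelOf w l (K l)) Ψ with hv
  have h1 : ‖v‖ ^ 2 ≤ √5 * √(∑ l ∈ S, hsNormSq (K l)) *
      (√(Q v) * √(Q Ψ)) := by
    refine le_trans (le_of_eq ?_) (hw.norm_inner_sum_kernelOf_le hs K S v Ψ)
    have h0 : ∀ u, ∑ l ∈ S, inner ℂ u (kernelOf w l (K l) Ψ) =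
        inner ℂ u ((∑ l ∈ S, kernelOf w l (K l)) Ψ) := fun u => by rw [sum_apply, inner_sum]
    rw [h0, ← hv, inner_self_eq_norm_sq_to_K, norm_pow, RCLike.norm_ofReal, abs_norm]
  have h2 : √(Q v) * √(Q Ψ) ≤
      C * (‖v‖ * ‖Ψ‖) := by
    rw [← Real.sqrt_mul (hw.nonneg v)]
    refine Real.sqrt_le_iff.mpr ⟨by positivity, ?_⟩
    refine (mul_le_mul (hw.le v) (hw.le Ψ)
      (hw.nonneg Ψ) (by positivity)).trans (le_of_eq ?_)
    ring
  have h3 := h1.trans (mul_le_mul_of_nonneg_left h2 (by positivity))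
  rcases (norm_nonneg v).eq_or_lt with h0 | h0
  · rw [← h0]; positivity
  · refine le_of_mul_le_mul_left ?_ h0
    rw [← sq]
    exact h3.trans (le_of_eq (by ring))

theorem IsHopping.summable_kernelOf [CompleteSpace H] (hw : IsHopping kF w Q C) (hs : 0 < s)
    (K : (l : NonzeroMomentum) → LuneSpace kF l →ₗ[ℝ] LuneSpace kF l)
    (hsum : Summable fun l => hsNormSq (K l)) :
    Summable fun l : NonzeroMomentum => kernelOf w l (K l) := by
  rw [summable_iff_vanishing_norm] at hsum ⊢
  intro ε hε
  have hC := hw.pos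
  have hc : 0 < √5 * C := by positivity
  -- The operator norm is controlled by the square root of the Hilbert–Schmidt tail, hence the
  -- squared tolerance.
  obtain ⟨S, hS⟩ := hsum ((ε / (√5 * C)) ^ 2) (by positivity)
  refine ⟨S, fun t ht => (hw.norm_sum_kernelOf_le hs K t).trans_lt ?_⟩
  have h1 : √(∑ l ∈ t, hsNormSq (K l)) < ε / (√5 * C) := by
    rw [Real.sqrt_lt' (by positivity)]
    exact (le_abs_self _).trans_lt (hS t ht)
  rw [lt_div_iff₀ hc] at h1
  linarith

theorem hasSum_inner_apply {ι : Type*} {f : ι → H →L[ℂ] H} {T : H →L[ℂ] H} (h : HasSum f T)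
    (Φ Ψ : H) : HasSum (fun i => inner ℂ Φ (f i Ψ)) (inner ℂ Φ (T Ψ)) :=
  (innerSL ℂ Φ).hasSum ((ContinuousLinearMap.apply ℂ H Ψ).hasSum h)

theorem IsHopping.norm_inner_tsum_kernelOf_le [CompleteSpace H] (hw : IsHopping kF w Q C)
    (hs : 0 < s)
    (K : (l : NonzeroMomentum) → LuneSpace kF l →ₗ[ℝ] LuneSpace kF l)
    (hsum : Summable fun l => hsNormSq (K l)) (Φ Ψ : H) :
    ‖inner ℂ Φ ((∑' l : NonzeroMomentum, kernelOf w l (K l)) Ψ)‖ ≤ √5 * √(∑' l, hsNormSq (K l)) *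
      √(Q Φ * Q Ψ) := by
  have h0 := (hw.summable_kernelOf hs K hsum).hasSum
  have h1 := hasSum_inner_apply h0 Φ Ψ
  refine le_of_tendsto (h1.norm) (Filter.Eventually.of_forall fun S => ?_)
  rw [Real.sqrt_mul (hw.nonneg Φ)]
  refine (hw.norm_inner_sum_kernelOf_le hs K S Φ Ψ).trans ?_
  have h2 := hsum.sum_le_tsum S fun l _ => hsNormSq_nonneg kF (K l)
  gcongr

end AbstractKernel

/-! ### The hopping operators on `ℋ_N` and the conclusion. -/

theorem isHopping_hop (s : ℕ) (kF : ℝ) :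
    IsHopping kF (hop s kF) (excitationForm s kF) (particleNumber s kF + 1) where
  inner_left := inner_hop_left s kF
  pos := by positivity
  nonneg := excitationForm_nonneg s kF
  le := excitationForm_le s kF
  norm_inner_sum_le := norm_inner_sum_hop_hop_le s kF

end FermiGas

theorem mainTheorem10 (s : ℕ) (hs : 0 < s) (kF : ℝ) (hkF : 0 < kF)
    (K : (l : NonzeroMomentum) → LuneSpace kF l →ₗ[ℝ] LuneSpace kF l)
    (hsymm : ∀ l, (K l).IsSymmetric)
    (hsum : Summable fun l => hsNormSq (K l)) :
    (∀ Ψ : ManyBody s kF, Summable fun a : OuterState s kF => hop s kF a.1 a.1 Ψ) ∧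
    (Summable fun l : NonzeroMomentum => kernelTerm s kF l (K l)) ∧
    ∀ Φ Ψ : ManyBody s kF,
      ‖inner ℂ Φ (bogolubovKernel s kF K Ψ)‖ ≤
        √5 * √(∑' l, hsNormSq (K l)) *
          √((inner ℂ Φ (excitationNumber s kF Φ + Φ)).re *
            (inner ℂ Ψ (excitationNumber s kF Ψ + Ψ)).re) :=
  -- With `w = hop s kF`, `kernelOf` agrees definitionally with `kernelTerm`, and `excitationForm`
  -- with the displayed quadratic form, so the abstract results apply as they stand.
  ⟨summable_hop_outer s kF, (isHopping_hop s kF).summable_kernelOf hs K hsum,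
    (isHopping_hop s kF).norm_inner_tsum_kernelOf_le hs K hsum⟩
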